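/- Let $J$ be a Euclidean Jordan algebra, i.e. a finite-dimensional real vector space with a bilinear commutative product satisfying $a(ba^2)=(ab)a^2$ for all $a,b$ and such that $a^2+b^2=0$ implies $a=b=0$; such an algebra has a unit $e$. A Jordan frame is a family $(p_i)_{i=1}^r$ of mutually orthogonal primitive idempotents with $\sum_i p_i=e$. Every $x\in J$ can be written $x=\sum_i\lambda_i p_i$ for a Jordan frame $(p_i)$ and real numbers $\lambda_i$, its eigenvalues, which are unique up to order; put $\operatorname{tr}x=\sum_i\lambda_i$. Let $\mathcal C\subset J$ be the symmetric cone of all elements with only positive eigenvalues. For $a,b\in\mathcal C$ put $M(a,b)=\inf\{t>0\mid tb-a\in\mathcal C\}$, and let $$d_T(a,b)=\log\max\big(M(a,b),M(b,a)\big),\qquad d_H(a,b)=\log\big(M(a,b)\,M(b,a)\big)$$ be the Thompson metric and the Hilbert pseudo-metric (which induces a metric on the set of rays of $\mathcal C$). Let $L(x)y=xy$ and $P(x)=2L(x)^2-L(x^2)$, and endow $\mathcal C$ with the Riemannian metric $\langle u,v\rangle_x=\operatorname{tr}\big((P(x)^{-1}u)\,v\big)$, $x\in\mathcal C$, $u,v\in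 J$. For $x\in\mathcal C$ the geodesic inversion $i_x$ is the map that sends $\gamma(1)$ to $\gamma(-1)$ for every Riemannian geodesic $\gamma:\mathbb R\to\mathcal C$ with $\gamma(0)=x$. Then: 1. Every $a\in\mathcal C$ has a unique inverse $a^{-1}$ in $J$ (i.e. $aa^{-1}=e$ and $a^2a^{-1}=a$), and $M(a,b)=M(b^{-1},a^{-1})$ for all $a,b\in\mathcal C$. 2. The map $a\mapsto a^{-1}$ is a bijection of $\mathcal C$ onto itself that preserves both $d_T$ and $d_H$, and it is equal to the geodesic inversion $i_e$. 3. For every $x\in\mathcal C$ the geodesic inversion $i_x$ is well defined on all of $\mathcal C$; it is a bijection of $\mathcal C$ onto itself that preserves both $d_T$ and $d_H$, and it maps rays to rays. Hence it is an isometry for both the Thompson and the Hilbert metric. -/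

import Mathlib

open scoped BigOperators

noncomputable section

namespace EuclideanJordan

/- The additive and topological structure of `J` comes from a norm, which is arbitrary: `J` will be
finite dimensional, so only its canonical vector space topology matters. The (non-associative)
Jordan product is the operation `*`. -/

section Algebra

variable {J : Type*} [NormedAddCommGroup J] [NormedSpace ℝ J] [CommMagma J]

/-- `e` is the identity element of the algebra. -/
def IsIdentity (e : J) : Prop := ∀ y : J, e * y = y

/-- A nonzero idempotent that is not the sum of two nonzero orthogonal idempotents. -/
structure IsPrimitiveIdempotent (p : J) : Prop where
  mul_self : p * p = p
  ne_zero : p ≠ 0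
  indecomposable : ∀ q q' : J, q * q = q → q' * q' = q' → q * q' = 0 → p = q + q' →
    q = 0 ∨ q' = 0

/-- Mutually orthogonal primitive idempotents whose sum is the identity. -/
structure IsJordanFrame {r : ℕ} (p : Fin r → J) : Prop where
  primitive : ∀ i, IsPrimitiveIdempotent (p i)
  orthogonal : ∀ i j, i ≠ j → p i * p j = 0
  sum_identity : IsIdentity (∑ i, p i)

/-- `x = ∑ lam i • p i` is a spectral decomposition of `x`, with eigenvalues `lam i`
(repeated according to multiplicity). -/
def IsSpectralDecomposition (x : J) {r : ℕ} (p : Fin r → J) (lam : Fin r → ℝ) : Prop :=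
  IsJordanFrame p ∧ x = ∑ i, lam i • p i

variable (J) in
/-- The symmetric cone of `J`: the elements all of whose eigenvalues are positive. -/
def symmetricCone : Set J :=
  {x | ∃ (r : ℕ) (p : Fin r → J) (lam : Fin r → ℝ),
    IsSpectralDecomposition x p lam ∧ ∀ i, 0 < lam i}

open Classical in
/-- The trace of `x`: the sum of its eigenvalues with multiplicity. -/
def jtrace (x : J) : ℝ :=
  if h : ∃ s : ℝ, ∃ (r : ℕ) (p : Fin r → J) (lam : Fin r → ℝ),
      IsSpectralDecomposition x p lam ∧ s = ∑ i, lam i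
  then h.choose else 0

/-- `b` is the Jordan inverse of `a`: `ab = e` and `a²b = a`. -/
def IsJordanInverse (a b : J) : Prop := IsIdentity (a * b) ∧ (a * a) * b = a

open Classical in
/-- The Jordan inverse `a⁻¹` (and `0` if `a` is not invertible). -/
def jinv (a : J) : J := if h : ∃ b : J, IsJordanInverse a b then h.choose else 0

/-- `M(a,b) = inf {t > 0 | t b - a ∈ C}` for the symmetric cone `C`. -/
def M (a b : J) : ℝ := sInf {t : ℝ | 0 < t ∧ t • b - a ∈ symmetricCone J}

/-- The Thompson metric. -/
def thompsonDist (a b : J) : ℝ := Real.log (max (M a b) (M b a))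

/-- The Hilbert (pseudo-)metric. -/
def hilbertDist (a b : J) : ℝ := Real.log (M a b * M b a)

/-- `f` restricts to a bijection of the symmetric cone onto itself that preserves `d`. -/
def IsConeIsometry (d : J → J → ℝ) (f : J → J) : Prop :=
  Set.BijOn f (symmetricCone J) (symmetricCone J) ∧
    ∀ a ∈ symmetricCone J, ∀ b ∈ symmetricCone J, d (f a) (f b) = d a b

end Algebra

section Riemannian

variable {J : Type*} [NormedAddCommGroup J] [NormedSpace ℝ J] [CommMagma J]
  [LeftDistribClass J] [SMulCommClass ℝ J J]

/-- The multiplication operator `L(x) : y ↦ x y`. -/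
def L (x : J) : Module.End ℝ J where
  toFun y := x * y
  map_add' := mul_add x
  map_smul' c y := mul_smul_comm c x y

/-- The quadratic representation `P(x) = 2 L(x)² - L(x²)`. -/
def P (x : J) : Module.End ℝ J := (2 : ℝ) • (L x * L x) - L (x * x)

/-- The Riemannian metric `⟨u, v⟩_x = tr ((P(x)⁻¹ u) v)` at the point `x` of the cone. -/
def metric (x u v : J) : ℝ := jtrace (Ring.inverse (P x) u * v)

/-- Complete affinely parametrized geodesics `γ : ℝ → C` of the Riemannian metric, in the global
chart given by the inclusion of the cone in `J`. The equation
`d/dt ⟨γ', v⟩_γ = ½ (∂_v ⟨·,·⟩)_γ (γ', γ')` for all `v` is the geodesic equation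
`γ'' + Γ_γ (γ', γ') = 0` with the index lowered. -/
structure IsGeodesic (γ : ℝ → J) : Prop where
  mem : ∀ t, γ t ∈ symmetricCone J
  differentiable : Differentiable ℝ γ
  differentiable_deriv : Differentiable ℝ (deriv γ)
  equation : ∀ (t : ℝ) (v : J),
    HasDerivAt (fun s : ℝ => metric (γ s) (deriv γ s) v)
      (2⁻¹ * deriv (fun s : ℝ => metric (γ t + s • v) (deriv γ t) (deriv γ t)) 0) t

/-- `z` is the reflection of `y` in `x` along a geodesic through `x`. -/
def IsGeodesicReflection (x y z : J) : Prop :=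
  ∃ γ : ℝ → J, IsGeodesic γ ∧ γ 0 = x ∧ γ 1 = y ∧ γ (-1) = z

open Classical in
/-- The geodesic inversion (geodesic symmetry) `i_x` at `x`, sending `γ 1` to `γ (-1)` for
geodesics `γ` with `γ 0 = x`. -/
def geodesicInversion (x y : J) : J :=
  if h : ∃ z : J, IsGeodesicReflection x y z then h.choose else 0

end Riemannian

end EuclideanJordan

end

open scoped BigOperators

noncomputable section

namespace EuclideanJordan

/-! Everything rests on the formula i_x(y) = P(x) y⁻¹ on the cone (`geodesicInversion_eq`). For x in
the cone, P(x) is a linear automorphism of the cone, so it preserves M (`M_P`). Inversion reverses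
the cone order: P(a^(-1/2)) reduces b - a ∈ C to the case a = e, where it says that the eigenvalues
of b exceed 1 (`jinv_sub_jinv_mem`). Hence M(a,b) = M(b⁻¹,a⁻¹), so i_x exchanges M(a,b) and M(b,a),
and both metrics are symmetric in these two numbers.

For the formula, the momentum w = P(γ)⁻¹γ' turns the geodesic equation into γ' = P(γ)w, w' = -P(w)γ
(`isGeodesic_iff`). By the fundamental formula, (γ, w) ↦ (P(b)γ, P(b)⁻¹w) preserves this system. The
solution through e with w(0) = ∑ λ_i p_i is γ(t) = ∑ exp(tλ_i) p_i, which t ↦ -t inverts. If b² = x,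
then P(b) carries e to x.

The Jordan theory is built from the axioms. Power associativity and formal reality give spectral
decompositions; the form Tr L(xy) is associative and positive definite, which yields the unit and
the self-duality of the cone. The fundamental formula comes from integrating `P_derivation` along
exp(tL(v)) (`PCLM_expL`). The trace in the metric, defined through eigenvalues, is linear because
non-orthogonal primitive idempotents have equal Tr L (`exists_isTraceForm_jtrace`). -/

set_option linter.unusedSectionVars false

/-! ### Operator identities from the Jordan axiom. -/

section Basic

variable {J : Type*} [NormedAddCommGroup J] [NormedSpace ℝ J] [CommMagma J]
  [LeftDistribClass J] [SMulCommClass ℝ J J]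

instance : RightDistribClass J := ⟨fun a b c => by rw [mul_comm, mul_add, mul_comm c, mul_comm c]⟩

instance : IsScalarTower ℝ J J :=
  ⟨fun c a b => by rw [smul_eq_mul, smul_eq_mul, mul_comm, mul_smul_comm, mul_comm]⟩

lemma L_apply (x y : J) : L x y = x * y := rfl

variable (J) in
/-- The Jordan product as a bilinear map. -/
def mulMap : J →ₗ[ℝ] Module.End ℝ J where
  toFun := L
  map_add' x y := by ext z; simp [L_apply, add_mul]
  map_smul' c x := by ext z; exact smul_mul_assoc c x z

lemma L_add (x y : J) : L (x + y) = L x + L y := map_add (mulMap J) x y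
lemma L_smul (c : ℝ) (x : J) : L (c • x) = c • L x := map_smul (mulMap J) c x

lemma jmul_zero (x : J) : x * 0 = 0 := map_zero (L x)
lemma jzero_mul (x : J) : 0 * x = 0 := by rw [mul_comm, jmul_zero]
lemma jmul_sub (x y z : J) : x * (y - z) = x * y - x * z := map_sub (L x) y z
lemma jsub_mul (x y z : J) : (x - y) * z = x * z - y * z := by
  rw [mul_comm, jmul_sub, mul_comm z, mul_comm z]
lemma jneg_mul (x y : J) : -x * y = -(x * y) := by
  rw [mul_comm, ← L_apply y (-x), map_neg, L_apply, mul_comm]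
lemma jmul_sum {ι : Type*} (x : J) (s : Finset ι) (f : ι → J) :
    x * ∑ i ∈ s, f i = ∑ i ∈ s, x * f i := map_sum (L x) f s
lemma jsum_mul {ι : Type*} (x : J) (s : Finset ι) (f : ι → J) :
    (∑ i ∈ s, f i) * x = ∑ i ∈ s, f i * x := by
  simp only [mul_comm _ x, jmul_sum]

lemma P_apply (x y : J) : P x y = (2 : ℝ) • (x * (x * y)) - (x * x) * y := rfl

lemma IsIdentity.mul_right {e : J} (he : IsIdentity e) (y : J) : y * e = y := by
  rw [mul_comm, he]

lemma IsIdentity.unique {e f : J} (he : IsIdentity e) (hf : IsIdentity f) : e = f := by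
  rw [← hf e, he.mul_right]

lemma IsIdentity.P_eq {e : J} (he : IsIdentity e) : P e = 1 := by
  ext y; simp only [P_apply, he _, two_smul, add_sub_cancel_right, Module.End.one_apply]

lemma IsIdentity.P_apply_self {e : J} (he : IsIdentity e) (x : J) : P x e = x * x := by
  rw [P_apply, he.mul_right, he.mul_right, two_smul, add_sub_cancel_right]

variable [IsCommJordan J]

lemma L_sq_commute (a : J) : L a * L (a * a) = L (a * a) * L a := by
  ext b
  change a * ((a * a) * b) = (a * a) * (a * b)
  have := IsCommJordan.lmul_comm_rmul_rmul a b
  rw [mul_comm (a * a) b, ← this, mul_comm]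

/-- The fully linearized Jordan identity. -/
lemma jordan_linearized (a b c : J) :
    L a * L (b * c) + L b * L (c * a) + L c * L (a * b) =
      L (b * c) * L a + L (c * a) * L b + L (a * b) * L c := by
  have h1 := L_sq_commute (a + b + c)
  have h2 := L_sq_commute (a + b)
  have h3 := L_sq_commute (b + c)
  have h4 := L_sq_commute (a + c)
  have ha := L_sq_commute a
  have hb := L_sq_commute b
  have hc := L_sq_commute c
  rw [mul_comm c a]
  simp only [mul_add, add_mul, L_add, mul_comm b a, mul_comm c a, mul_comm c b] at h1 h2 h3 h4
  -- Polarization: inclusion-exclusion over partial sums of a + b + c isolates the trilinear part,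
  -- which occurs twice.
  have key : (2 : ℝ) • (L a * L (b * c) + L b * L (a * c) + L c * L (a * b)) =
      (2 : ℝ) • (L (b * c) * L a + L (a * c) * L b + L (a * b) * L c) := by
    linear_combination (norm := module) h1 - h2 - h3 - h4 + ha + hb + hc
  exact smul_right_injective _ two_ne_zero key

lemma L_sq_commutator (a b : J) :
    L a * L (b * b) + (2 : ℝ) • (L b * L (a * b)) =
      L (b * b) * L a + (2 : ℝ) • (L (a * b) * L b) := by
  have h := jordan_linearized a b b
  rw [mul_comm b a] at h
  linear_combination (norm := module) h

/-- The multiplication operator of a triple product. -/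
lemma L_mul_mul (a b c : J) :
    L (a * (b * c)) = L a * L (b * c) + L b * L (a * c) + L c * L (a * b)
      - L b * L a * L c - L c * L a * L b := by
  ext d
  -- Both instances have right-hand side (ab)(cd) + (ac)(bd) + (bc)(ad), so their left-hand sides
  -- agree; one of them contains ((bc)a)d.
  have h := congrArg (fun T : Module.End ℝ J => T a) (jordan_linearized b c d)
  have h' := congrArg (fun T : Module.End ℝ J => T d) (jordan_linearized a b c)
  simp only [LinearMap.add_apply, LinearMap.sub_apply, Module.End.mul_apply, L_apply] at h h' ⊢
  simp only [mul_comm] at h h' ⊢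
  linear_combination (norm := module) h - h'

lemma commute_of_mul_eq {p u : J} (hp : p * p = p) (h : p * u = u) :
    L u * L p = L p * L u := by
  have := L_sq_commutator u p
  rw [hp, mul_comm u p, h] at this
  linear_combination (norm := module) -this

/-- The infinitesimal form of the fundamental formula for the quadratic representation. -/
lemma P_derivation (x y : J) :
    (2 : ℝ) • (L y * L (x * y) + L (x * y) * L y - L (y * (x * y))) =
      L x * P y + P y * L x := by
  have h1 := L_sq_commutator x y
  have h2 := L_mul_mul y x y
  simp only [P, mul_sub, sub_mul, h2, mul_smul_comm, smul_mul_assoc, mul_comm y x, ← mul_assoc]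
  linear_combination (norm := module) -h1

end Basic

/-! ### Power associativity. -/

section PowerAssociativity

open Polynomial

variable {J : Type*} [NormedAddCommGroup J] [NormedSpace ℝ J] [CommMagma J]
  [LeftDistribClass J] [SMulCommClass ℝ J J]

/-- The element `x f(x)` of the (non-unital) subalgebra generated by `x`. -/
def evalMul (x : J) : ℝ[X] →ₗ[ℝ] J :=
  (LinearMap.applyₗ x).comp (aeval (L x)).toLinearMap

lemma evalMul_apply (x : J) (f : ℝ[X]) : evalMul x f = aeval (L x) f x := rfl

lemma evalMul_mul (x : J) (f g : ℝ[X]) : evalMul x (f * g) = aeval (L x) f (evalMul x g) := by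
  simp [evalMul_apply]

lemma evalMul_one (x : J) : evalMul x 1 = x := by simp [evalMul_apply]

lemma evalMul_X_mul (x : J) (f : ℝ[X]) : evalMul x (X * f) = x * evalMul x f := by
  simp [evalMul_mul, L_apply]

lemma evalMul_mem {x : J} {V : Submodule ℝ J} (hx : x ∈ V) (hV : ∀ y ∈ V, x * y ∈ V) (f : ℝ[X]) :
    evalMul x f ∈ V := by
  induction f using Polynomial.induction_on' with
  | add f g hf hg => rw [map_add]; exact V.add_mem hf hg
  | monomial n c =>
    rw [← C_mul_X_pow_eq_monomial, ← smul_eq_C_mul, map_smul]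
    refine V.smul_mem _ ?_
    induction n with
    | zero => simpa [evalMul_one] using hx
    | succ n ih => rw [pow_succ', evalMul_X_mul]; exact hV _ ih

variable [IsCommJordan J]

/-- `evalMul x (X ^ n)` is x^(n+1), no unit being available yet. Since x^(n+3) = x(x x^(n+1)),
`L_mul_mul` expresses its operator through L(x), L(x²) and operators of lower powers; the induction
closes because commutation with both L(x) and L(x²) is carried along. -/
lemma L_evalMul_X_pow_commute (x : J) (n : ℕ) :
    Commute (L x) (L (evalMul x (X ^ n))) ∧ Commute (L (x * x)) (L (evalMul x (X ^ n))) := by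
  have h0 : Commute (L x) (L (x * x)) := L_sq_commute x
  induction n using Nat.strong_induction_on with
  | _ n ih =>
    match n with
    | 0 => rw [pow_zero, evalMul_one]; exact ⟨Commute.refl _, h0.symm⟩
    | 1 => rw [pow_one, ← mul_one X, evalMul_X_mul, evalMul_one]; exact ⟨h0, Commute.refl _⟩
    | n + 2 =>
      obtain ⟨h1, h2⟩ := ih n (by omega)
      obtain ⟨h3, h4⟩ := ih (n + 1) (by omega)
      rw [pow_succ', evalMul_X_mul] at h3 h4
      rw [pow_succ', pow_succ', evalMul_X_mul, evalMul_X_mul]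
      set u := evalMul x (X ^ n)
      rw [L_mul_mul]
      constructor
      · have := Commute.refl (L x)
        exact ((((this.mul_right h3).add_right (this.mul_right h3)).add_right
          (h1.mul_right h0)).sub_right ((this.mul_right this).mul_right h1)).sub_right
          ((h1.mul_right this).mul_right this)
      · have := h0.symm
        exact ((((this.mul_right h4).add_right (this.mul_right h4)).add_right
          (h2.mul_right (Commute.refl _))).sub_right ((this.mul_right this).mul_right h2)).sub_right
          ((h2.mul_right this).mul_right this)

lemma L_evalMul_commute (x : J) (f : ℝ[X]) : Commute (L x) (L (evalMul x f)) := by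
  induction f using Polynomial.induction_on' with
  | add f g hf hg => rw [map_add, L_add]; exact hf.add_right hg
  | monomial n c =>
    rw [← C_mul_X_pow_eq_monomial, ← smul_eq_C_mul, map_smul, L_smul]
    exact (L_evalMul_X_pow_commute x n).1.smul_right c

/-- Power associativity. -/
lemma evalMul_mul_evalMul (x : J) (f g : ℝ[X]) :
    evalMul x f * evalMul x g = evalMul x (X * (f * g)) := by
  have h : Commute (aeval (L x) g) (L (evalMul x f)) := by
    induction g using Polynomial.induction_on' with
    | add p q hp hq => rw [map_add]; exact hp.add_left hq
    | monomial n c =>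
      rw [← C_mul_X_pow_eq_monomial, ← smul_eq_C_mul, map_smul, map_pow, aeval_X]
      exact ((L_evalMul_commute x f).pow_left n).smul_left c
  have h2 := congrArg (fun T : Module.End ℝ J => T x) h.eq
  simp only [Module.End.mul_apply, L_apply] at h2
  rw [evalMul_apply x g, ← h2, mul_comm f g, mul_left_comm, evalMul_mul, evalMul_X_mul, mul_comm x]

end PowerAssociativity

/-! ### Spectral decomposition inside the algebra generated by one element. -/

section Spectral

open Polynomial

variable {J : Type*} [NormedAddCommGroup J] [NormedSpace ℝ J] [CommMagma J]
  [LeftDistribClass J] [SMulCommClass ℝ J J]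

variable (J) in
/-- The algebra is formally real: a sum of two squares vanishes only trivially. -/
def FormallyReal : Prop := ∀ a b : J, a * a + b * b = 0 → a = 0 ∧ b = 0

lemma FormallyReal.eq_zero_of_mul_self (hreal : FormallyReal J) {a : J} (h : a * a = 0) : a = 0 :=
  (hreal a 0 (by rw [h, jzero_mul, add_zero])).1

/-- The ideal of polynomials `f` with `x f(x) = 0`. -/
def annihilator (x : J) : Ideal ℝ[X] where
  carrier := {f | evalMul x f = 0}
  add_mem' {f g} hf hg := by
    simp only [Set.mem_ofPred_eq] at *
    rw [map_add, hf, hg, add_zero]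
  zero_mem' := map_zero _
  smul_mem' f g hg := by
    simp only [Set.mem_ofPred_eq] at *
    rw [smul_eq_mul, evalMul_mul, hg, map_zero]

lemma mem_annihilator {x : J} {f : ℝ[X]} : f ∈ annihilator x ↔ evalMul x f = 0 := Iff.rfl

variable [IsCommJordan J]

lemma FormallyReal.mem_annihilator_of_sq (hreal : FormallyReal J) {x : J} {f : ℝ[X]}
    (h : f * f ∈ annihilator x) : f ∈ annihilator x := by
  refine hreal.eq_zero_of_mul_self ?_
  rw [evalMul_mul_evalMul]
  exact (annihilator x).mul_mem_left X h

lemma FormallyReal.mem_annihilator_of_sq_add_sq (hreal : FormallyReal J) {x : J} {f g : ℝ[X]}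
    (h : f * f + g * g ∈ annihilator x) : f ∈ annihilator x ∧ g ∈ annihilator x := by
  refine hreal _ _ ?_
  rw [evalMul_mul_evalMul, evalMul_mul_evalMul, ← map_add, ← mul_add]
  exact (annihilator x).mul_mem_left X h

lemma annihilator_ne_bot [FiniteDimensional ℝ J] (x : J) : annihilator x ≠ ⊥ := by
  intro h
  have h1 : minpoly ℝ (L x) ∈ annihilator x := by
    rw [mem_annihilator, evalMul_apply, minpoly.aeval, LinearMap.zero_apply]
  rw [h, Ideal.mem_bot] at h1
  exact minpoly.ne_zero (Algebra.IsIntegral.isIntegral (L x)) h1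

/-- The annihilator of an element is generated by a polynomial with simple real roots. -/
lemma FormallyReal.exists_nodal_mem_annihilator [FiniteDimensional ℝ J] (hreal : FormallyReal J)
    (x : J) : ∃ S : Finset ℝ, Lagrange.nodal S id ∈ annihilator x := by
  obtain ⟨m, hm⟩ := IsPrincipalIdealRing.principal (annihilator x)
  have hmem : ∀ f, f ∈ annihilator x ↔ m ∣ f := fun f => by
    rw [hm]; exact Ideal.mem_span_singleton
  have hm0 : m ≠ 0 := by
    rintro rfl
    exact annihilator_ne_bot x (by rw [hm]; simp)
  have hroot : ∀ z : ℂ, aeval z m = 0 → z.im = 0 := by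
    intro z hz
    by_contra him
    obtain ⟨h, hh⟩ := Polynomial.quadratic_dvd_of_aeval_eq_zero_im_ne_zero m hz him
    -- Here m = ((X - Re z)² + (Im z)²) h, so this sum of squares is m h. Formal reality then puts
    -- h, of smaller degree than m, in the ideal.
    have key : ((X - C z.re) * h) * ((X - C z.re) * h) + (C z.im * h) * (C z.im * h)
        ∈ annihilator x := by
      rw [hmem, hh]
      refine ⟨h, ?_⟩
      rw [Complex.sq_norm, Complex.normSq_apply]
      simp only [C_add, C_mul, C_ofNat]
      ring
    have h2 := (hmem _).1 (hreal.mem_annihilator_of_sq_add_sq key).2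
    have h3 : m ∣ h := by
      have h4 := h2.mul_left (C z.im⁻¹)
      rwa [← mul_assoc, ← C_mul, inv_mul_cancel₀ him, C_1, one_mul] at h4
    have hh0 : h ≠ 0 := by rintro rfl; rw [mul_zero] at hh; exact hm0 hh
    have hq : (X ^ 2 - C (2 * z.re) * X + C (‖z‖ ^ 2) : ℝ[X]) ∣ 1 := by
      rw [hh] at h3
      have : (X ^ 2 - C (2 * z.re) * X + C (‖z‖ ^ 2)) * h ∣ 1 * h := by rwa [one_mul]
      exact (mul_dvd_mul_iff_right hh0).1 this
    have hdeg := natDegree_eq_zero_of_isUnit (isUnit_of_dvd_one hq)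
    have : (X ^ 2 - C (2 * z.re) * X + C (‖z‖ ^ 2) : ℝ[X]).natDegree = 2 := by compute_degree!
    omega
  have hsplit : m.Splits := by
    obtain ⟨u, hu⟩ := UniqueFactorizationMonoid.factors_prod hm0
    rw [← hu]
    refine (Splits.multisetProd fun g hg' => Splits.of_degree_eq_one ?_).mul
      u.isUnit.splits
    have hg := UniqueFactorizationMonoid.irreducible_of_factor g hg'
    have hgm := UniqueFactorizationMonoid.dvd_of_mem_factors hg'
    obtain ⟨z, hz⟩ := IsAlgClosed.exists_aeval_eq_zero ℂ g hg.degree_pos.ne'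
    have him : z.im = 0 := hroot z (by
      obtain ⟨k, rfl⟩ := hgm
      rw [map_mul, hz, zero_mul])
    have hzr : z = ((z.re : ℝ) : ℂ) := Complex.ext rfl (by simp [him])
    refine degree_eq_one_of_irreducible_of_root hg (x := z.re) ?_
    rw [hzr] at hz
    have : aeval (algebraMap ℝ ℂ z.re) g = 0 := hz
    rw [aeval_algebraMap_apply] at this
    simpa using this
  have hnodup : m.roots.Nodup := by
    rw [Multiset.nodup_iff_count_le_one]
    intro a
    rw [count_roots]
    by_contra! hlt
    obtain ⟨h, hh⟩ := (le_rootMultiplicity_iff hm0).1 (Nat.succ_le_of_lt hlt)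
    -- A double root gives m = (X - a)² h, and the square of (X - a) h is m h.
    have key : (X - C a) * h ∈ annihilator x := by
      refine hreal.mem_annihilator_of_sq ((hmem _).2 ⟨h, ?_⟩)
      rw [hh]; ring
    have hh0 : h ≠ 0 := by rintro rfl; rw [mul_zero] at hh; exact hm0 hh
    have h2 : ((X - C a) * ((X - C a) * h)) ∣ 1 * ((X - C a) * h) := by
      rw [one_mul]
      convert (hmem _).1 key using 1
      rw [hh]; ring
    have h3 := (mul_dvd_mul_iff_right (mul_ne_zero (X_sub_C_ne_zero a) hh0)).1 h2
    exact not_isUnit_X_sub_C a (isUnit_of_dvd_one h3)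
  refine ⟨m.roots.toFinset, (hmem _).2 ?_⟩
  have h1 := hsplit.eq_prod_roots
  have h2 : Lagrange.nodal m.roots.toFinset id = (m.roots.map fun a => X - C a).prod := by
    rw [Lagrange.nodal_eq, Finset.prod, Multiset.toFinset_val, hnodup.dedup]
    rfl
  rw [h2]
  refine ⟨C m.leadingCoeff⁻¹, ?_⟩
  conv_rhs => arg 1; rw [h1]
  rw [mul_right_comm, ← C_mul, mul_inv_cancel₀ (leadingCoeff_ne_zero.2 hm0), C_1, one_mul]

/-- An element is the sum of eigenvectors of its own multiplication operator. -/
lemma FormallyReal.exists_eigenvector_decomposition [FiniteDimensional ℝ J]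
    (hreal : FormallyReal J) (x : J) :
    ∃ (S : Finset ℝ) (l : ℝ → ℝ[X]), x = ∑ a ∈ S, evalMul x (l a) ∧
      ∀ a ∈ S, x * evalMul x (l a) = a • evalMul x (l a) := by
  obtain ⟨S, hS⟩ := hreal.exists_nodal_mem_annihilator x
  refine ⟨S, Lagrange.basis S id, ?_, ?_⟩
  · rcases S.eq_empty_or_nonempty with rfl | hne
    · rw [Lagrange.nodal_empty, mem_annihilator, evalMul_one] at hS
      simpa using hS
    · rw [← map_sum, Lagrange.sum_basis (Set.injOn_id _) hne, evalMul_one]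
  · intro a ha
    -- X - a times the Lagrange polynomial at a is a multiple of the nodal polynomial, which
    -- annihilates x.
    have h1 : (X - C a) * Lagrange.basis S id a ∈ annihilator x := by
      rw [Lagrange.basis_eq_prod_sub_inv_mul_nodal_div ha, mul_left_comm,
        ← Lagrange.nodal_erase_eq_nodal_div ha]
      have := Lagrange.nodal_eq_mul_nodal_erase (v := (id : ℝ → ℝ)) ha
      rw [id] at this
      rw [← this]
      exact (annihilator x).mul_mem_left _ hS
    rw [mem_annihilator, sub_mul, map_sub, evalMul_X_mul, ← smul_eq_C_mul, map_smul,
      sub_eq_zero] at h1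
    exact h1

/-- The spectral theorem in the non-unital algebra generated by `x`. -/
lemma FormallyReal.exists_idempotent_decomposition [FiniteDimensional ℝ J]
    (hreal : FormallyReal J) (x : J) :
    ∃ (S : Finset ℝ) (p : ℝ → J), x = ∑ a ∈ S, a • p a ∧ (∀ a ∈ S, p a * p a = p a) ∧
      (∀ a ∈ S, ∀ b ∈ S, a ≠ b → p a * p b = 0) ∧ ∀ a ∈ S, ∃ f, p a = evalMul x f := by
  obtain ⟨S, l, hx, hl⟩ := hreal.exists_eigenvector_decomposition x
  set u : ℝ → J := fun a => evalMul x (l a) with hu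
  have horth : ∀ a ∈ S, ∀ b ∈ S, a ≠ b → u a * u b = 0 := by
    intro a ha b hb hab
    have h1 : x * (u a * u b) = a • (u a * u b) := by
      rw [← smul_mul_assoc, ← hl a ha, ← evalMul_X_mul]
      simp only [hu]
      rw [evalMul_mul_evalMul, ← evalMul_X_mul, evalMul_mul_evalMul]
      congr 1; ring
    have h2 : x * (u a * u b) = b • (u a * u b) := by
      rw [← mul_smul_comm, ← hl b hb, ← evalMul_X_mul]
      simp only [hu]
      rw [evalMul_mul_evalMul, ← evalMul_X_mul, evalMul_mul_evalMul]
      congr 1; ring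
    rw [h1, ← sub_eq_zero, ← sub_smul, smul_eq_zero, sub_eq_zero] at h2
    exact h2.resolve_left hab
  have hsq : ∀ a ∈ S, u a * u a = a • u a := by
    intro a ha
    have h1 : x * u a = ∑ b ∈ S, u b * u a := by
      conv_lhs => rw [hx]
      exact jsum_mul _ _ _
    rw [Finset.sum_eq_single_of_mem a ha (fun b hb hba => horth b hb a ha hba)] at h1
    rw [← h1, ← hl a ha]
  -- The scaling is forced by u_a² = a u_a. For a = 0 the convention 0⁻¹ = 0 gives the zero
  -- idempotent; nothing is lost, since u_0² = 0 forces u_0 = 0.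
  refine ⟨S, fun a => a⁻¹ • u a, ?_, ?_, ?_, ?_⟩
  · conv_lhs => rw [hx]
    refine Finset.sum_congr rfl fun a ha => ?_
    by_cases h0 : a = 0
    · have h1 := hsq a ha
      rw [h0, zero_smul] at h1
      rw [h0, zero_smul]
      exact hreal.eq_zero_of_mul_self h1
    · rw [smul_smul, mul_inv_cancel₀ h0, one_smul]
  · intro a ha
    by_cases h0 : a = 0
    · simp [h0, jmul_zero]
    · simp only [smul_mul_assoc, mul_smul_comm]
      rw [hsq a ha, smul_smul a⁻¹ a, inv_mul_cancel₀ h0, one_smul]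
  · intro a ha b hb hab
    simp only [smul_mul_assoc, mul_smul_comm]
    rw [horth a ha b hb hab, smul_zero, smul_zero]
  · exact fun a _ => ⟨a⁻¹ • l a, by simp [hu]⟩

end Spectral

/-! ### Peirce projections, the form Tr L(xy), and the unit. -/

section TraceForm

variable {J : Type*} [NormedAddCommGroup J] [NormedSpace ℝ J] [CommMagma J]
  [LeftDistribClass J] [SMulCommClass ℝ J J]

/-- A linear functional whose bilinear form `(x, y) ↦ T (x y)` is associative and positive
definite. -/
structure IsTraceForm (T : J →ₗ[ℝ] ℝ) : Prop where
  assoc : ∀ x y z : J, T ((x * y) * z) = T (x * (y * z))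
  pos : ∀ x : J, x ≠ 0 → 0 < T (x * x)

namespace IsTraceForm

variable {T : J →ₗ[ℝ] ℝ}

lemma nonneg (hT : IsTraceForm T) (x : J) : 0 ≤ T (x * x) := by
  by_cases h : x = 0
  · rw [h, jmul_zero, map_zero]
  · exact (hT.pos x h).le

lemma eq_zero (hT : IsTraceForm T) {x : J} (h : T (x * x) = 0) : x = 0 := by
  by_contra h0
  exact (hT.pos x h0).ne' h

lemma ext (hT : IsTraceForm T) {x y : J} (h : ∀ z, T (x * z) = T (y * z)) : x = y := by
  rw [← sub_eq_zero]
  apply hT.eq_zero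
  rw [jsub_mul, map_sub, h, sub_self]

lemma L_symm (hT : IsTraceForm T) (x y z : J) : T ((x * y) * z) = T (y * (x * z)) := by
  rw [mul_comm x y, hT.assoc]

lemma P_symm (hT : IsTraceForm T) (x y z : J) : T (P x y * z) = T (y * P x z) := by
  simp only [P_apply, jsub_mul, jmul_sub, map_sub, smul_mul_assoc, mul_smul_comm, map_smul]
  rw [hT.L_symm, hT.L_symm, hT.L_symm]

end IsTraceForm

/-- The projection onto the Peirce `1/2`-space of an idempotent. -/
def peirceHalf (p : J) : Module.End ℝ J := (4 : ℝ) • (L p - L p * L p)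

lemma IsTraceForm.peirceHalf_symm {T : J →ₗ[ℝ] ℝ} (hT : IsTraceForm T) (p y z : J) :
    T (peirceHalf p y * z) = T (y * peirceHalf p z) := by
  simp only [peirceHalf, LinearMap.smul_apply, LinearMap.sub_apply, Module.End.mul_apply, L_apply,
    jsub_mul, jmul_sub, map_sub, smul_mul_assoc, mul_smul_comm, map_smul]
  rw [hT.L_symm p y, hT.L_symm p _ z, hT.L_symm p y]

lemma P_idempotent_eq {p : J} (hp : p * p = p) : P p = (2 : ℝ) • (L p * L p) - L p := by
  rw [P, hp]

lemma L_eq_peirce {p : J} (hp : p * p = p) : L p = P p + (2⁻¹ : ℝ) • peirceHalf p := by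
  rw [P_idempotent_eq hp, peirceHalf]
  module

lemma P_idempotent_apply_self {p : J} (hp : p * p = p) : P p p = p := by
  rw [P_apply, hp, hp, two_smul, add_sub_cancel_right]

variable [IsCommJordan J]

lemma L_idempotent_cube {p : J} (hp : p * p = p) :
    (2 : ℝ) • (L p * L p * L p) = (3 : ℝ) • (L p * L p) - L p := by
  have h := L_mul_mul p p p
  rw [hp, hp] at h
  linear_combination (norm := module) h

lemma L_idempotent_cube' {p : J} (hp : p * p = p) :
    L p * L p * L p = (3 / 2 : ℝ) • (L p * L p) - (1 / 2 : ℝ) • L p := by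
  linear_combination (norm := module) (1 / 2 : ℝ) • L_idempotent_cube hp

lemma L_mul_P_idempotent {p : J} (hp : p * p = p) : L p * P p = P p := by
  rw [P_idempotent_eq hp]
  simp only [mul_sub, mul_smul_comm, ← mul_assoc, L_idempotent_cube' hp]
  module

lemma P_idempotent_mul_self {p : J} (hp : p * p = p) : P p * P p = P p := by
  nth_rewrite 1 [P_idempotent_eq hp]
  rw [sub_mul, smul_mul_assoc, mul_assoc, L_mul_P_idempotent hp, L_mul_P_idempotent hp]
  module

lemma peirceHalf_mul_self {p : J} (hp : p * p = p) : peirceHalf p * peirceHalf p = peirceHalf p := by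
  have h3 := L_idempotent_cube' hp
  simp only [peirceHalf, mul_sub, sub_mul, mul_smul_comm, smul_mul_assoc, smul_sub, ← mul_assoc, h3]
  module

/-- L(p) is P(p) plus half of `peirceHalf p`, two self-adjoint projections, so T((py)y) is a
weighted sum of squares. Positivity follows, and py = 0 in the case of equality. -/
lemma IsTraceForm.idempotent_mul_sq {T : J →ₗ[ℝ] ℝ} (hT : IsTraceForm T) {p : J} (hp : p * p = p)
    (y : J) : T (p * (y * y)) =
      T (P p y * P p y) + 2⁻¹ * T (peirceHalf p y * peirceHalf p y) := by
  rw [hT.P_symm, hT.peirceHalf_symm, ← Module.End.mul_apply, ← Module.End.mul_apply,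
    P_idempotent_mul_self hp, peirceHalf_mul_self hp, ← hT.assoc]
  have := congrArg (fun A : Module.End ℝ J => A y) (L_eq_peirce hp)
  simp only [L_apply, LinearMap.add_apply, LinearMap.smul_apply] at this
  rw [this, add_mul, map_add, smul_mul_assoc, map_smul, smul_eq_mul, mul_comm y, mul_comm y]

lemma IsTraceForm.idempotent_nonneg {T : J →ₗ[ℝ] ℝ} (hT : IsTraceForm T) {p : J} (hp : p * p = p)
    (y : J) : 0 ≤ T (p * (y * y)) := by
  rw [hT.idempotent_mul_sq hp]
  have := hT.nonneg (P p y)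
  have := hT.nonneg (peirceHalf p y)
  positivity

lemma IsTraceForm.mul_eq_zero_of_idempotent {T : J →ₗ[ℝ] ℝ} (hT : IsTraceForm T) {p : J}
    (hp : p * p = p) {y : J} (h : T (p * (y * y)) = 0) : p * y = 0 := by
  rw [hT.idempotent_mul_sq hp] at h
  have h1 := hT.nonneg (P p y)
  have h2 := hT.nonneg (peirceHalf p y)
  have h3 := hT.eq_zero (x := P p y) (by linarith)
  have h4 := hT.eq_zero (x := peirceHalf p y) (by linarith)
  have := congrArg (fun A : Module.End ℝ J => A y) (L_eq_peirce hp)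
  simpa only [L_apply, LinearMap.add_apply, LinearMap.smul_apply, h3, h4, smul_zero,
    add_zero] using this

section

variable [FiniteDimensional ℝ J]

lemma trace_idempotent_nonneg {E : Module.End ℝ J} (h : E * E = E) :
    0 ≤ LinearMap.trace ℝ J E := by
  have h' : IsIdempotentElem E := h
  rw [(LinearMap.IsIdempotentElem.isProj_range E h').trace]
  positivity

lemma trace_idempotent_pos {E : Module.End ℝ J} (h : E * E = E) (h0 : E ≠ 0) :
    0 < LinearMap.trace ℝ J E := by
  have h' : IsIdempotentElem E := h
  refine lt_of_le_of_ne (trace_idempotent_nonneg h) fun h1 => h0 ?_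
  exact LinearMap.IsIdempotentElem.trace_eq_zero_iff h' |>.1 h1.symm

variable (J) in
/-- The functional `x ↦ Tr L(x)`. -/
def traceL : J →ₗ[ℝ] ℝ := (LinearMap.trace ℝ J).comp (mulMap J)

lemma traceL_apply (x : J) : traceL J x = LinearMap.trace ℝ J (L x) := rfl

/-- By `L_mul_mul`, the operators of (xy)z and x(yz) differ only by triple products of
multiplication operators, whose traces cancel by cyclicity. -/
lemma traceL_assoc (x y z : J) : traceL J ((x * y) * z) = traceL J (x * (y * z)) := by
  rw [mul_comm (x * y) z, traceL_apply, traceL_apply, L_mul_mul, L_mul_mul, mul_comm z x,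
    mul_comm z y]
  simp only [map_add, map_sub]
  have h1 := LinearMap.trace_mul_cycle ℝ (L x) (L z) (L y)
  have h2 := LinearMap.trace_mul_cycle ℝ (L z) (L x) (L y)
  linarith

lemma traceL_idempotent_pos {p : J} (hp : p * p = p) (h0 : p ≠ 0) : 0 < traceL J p := by
  rw [traceL_apply, L_eq_peirce hp, map_add, map_smul, smul_eq_mul]
  have h1 := trace_idempotent_pos (P_idempotent_mul_self hp) (fun h => h0 (by
    rw [← P_idempotent_apply_self hp, h, LinearMap.zero_apply]))
  have h2 := trace_idempotent_nonneg (peirceHalf_mul_self hp)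
  positivity

lemma FormallyReal.isTraceForm_traceL (hreal : FormallyReal J) : IsTraceForm (traceL J) := by
  refine ⟨traceL_assoc, fun x hx => ?_⟩
  obtain ⟨S, p, hxp, hp, horth, -⟩ := hreal.exists_idempotent_decomposition x
  have hsq : x * x = ∑ a ∈ S, (a * a) • p a := by
    rw [hxp, jsum_mul]
    refine Finset.sum_congr rfl fun a ha => ?_
    rw [jmul_sum, Finset.sum_eq_single_of_mem a ha]
    · rw [smul_mul_assoc, mul_smul_comm, hp a ha, smul_smul]
    · intro b hb hba
      rw [smul_mul_assoc, mul_smul_comm, horth a ha b hb hba.symm, smul_zero, smul_zero]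
  have hpos : ∀ a ∈ S, 0 ≤ traceL J (p a) := fun a ha => by
    by_cases h : p a = 0
    · rw [h, map_zero]
    · exact (traceL_idempotent_pos (hp a ha) h).le
  rw [hsq, map_sum]
  simp only [map_smul, smul_eq_mul]
  obtain ⟨a, ha, hne⟩ : ∃ a ∈ S, a • p a ≠ 0 := by
    by_contra! h
    exact hx (by rw [hxp, Finset.sum_eq_zero h])
  rw [smul_ne_zero_iff] at hne
  refine Finset.sum_pos' (fun b hb => mul_nonneg (mul_self_nonneg b) (hpos b hb)) ⟨a, ha, ?_⟩
  exact mul_pos (mul_self_pos.2 hne.1) (traceL_idempotent_pos (hp a ha) hne.2)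

/-- A nondegenerate associative form yields an identity element. -/
lemma IsTraceForm.exists_identity {T : J →ₗ[ℝ] ℝ} (hT : IsTraceForm T) :
    ∃ e : J, IsIdentity e := by
  let B : J →ₗ[ℝ] J →ₗ[ℝ] ℝ := (LinearMap.llcomp ℝ J J ℝ T).comp (mulMap J)
  have hB : ∀ x y, B x y = T (x * y) := fun x y => rfl
  have hinj : Function.Injective B := by
    intro x y h
    exact hT.ext fun z => by rw [← hB, h, hB]
  have hsurj : Function.Surjective B :=
    (LinearMap.injective_iff_surjective_of_finrank_eq_finrank
      (Subspace.dual_finrank_eq (K := ℝ) (V := J)).symm).1 hinj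
  -- The element e representing T itself is the unit: T((ey)z) = T(e(yz)) = T(yz).
  obtain ⟨e, he⟩ := hsurj T
  refine ⟨e, fun y => hT.ext fun z => ?_⟩
  rw [hT.assoc, ← hB, he]

end

end TraceForm

/-! ### Jordan frames, the spectral theorem, and self-duality of the cone. -/

section Frames

variable {J : Type*} [NormedAddCommGroup J] [NormedSpace ℝ J] [CommMagma J]
  [LeftDistribClass J] [SMulCommClass ℝ J J]

/-- Orthogonal idempotents with sum the identity, such that `x = ∑ i, lam i • p i`. -/
structure IsIdempotentDecomposition {ι : Type} [Fintype ι] (x : J) (p : ι → J) (lam : ι → ℝ) :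
    Prop where
  idem : ∀ i, p i * p i = p i
  orthogonal : ∀ i j, i ≠ j → p i * p j = 0
  sum_identity : IsIdentity (∑ i, p i)
  eq_sum : x = ∑ i, lam i • p i

lemma sum_smul_mul_sum_smul {ι : Type*} [Fintype ι] {p : ι → J} (hidem : ∀ i, p i * p i = p i)
    (horth : ∀ i j, i ≠ j → p i * p j = 0) (lam mu : ι → ℝ) :
    (∑ i, lam i • p i) * (∑ i, mu i • p i) = ∑ i, (lam i * mu i) • p i := by
  rw [jsum_mul]
  refine Finset.sum_congr rfl fun i _ => ?_
  rw [jmul_sum, Finset.sum_eq_single_of_mem i (Finset.mem_univ i)]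
  · rw [smul_mul_assoc, mul_smul_comm, hidem, smul_smul]
  · intro j _ hj
    rw [smul_mul_assoc, mul_smul_comm, horth i j hj.symm, smul_zero, smul_zero]

lemma sum_smul_mul {ι : Type*} [Fintype ι] {p : ι → J} (hidem : ∀ i, p i * p i = p i)
    (horth : ∀ i j, i ≠ j → p i * p j = 0) (lam : ι → ℝ) (i : ι) :
    (∑ i, lam i • p i) * p i = lam i • p i := by
  rw [jsum_mul, Finset.sum_eq_single_of_mem i (Finset.mem_univ i)]
  · rw [smul_mul_assoc, hidem]
  · intro j _ hj
    rw [smul_mul_assoc, horth j i hj, smul_zero]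

namespace IsIdempotentDecomposition

variable {ι κ : Type} [Fintype ι] [Fintype κ] {x : J} {p : ι → J} {lam : ι → ℝ}

lemma reindex (h : IsIdempotentDecomposition x p lam) (f : κ ≃ ι) :
    IsIdempotentDecomposition x (p ∘ f) (lam ∘ f) where
  idem i := h.idem _
  orthogonal i j hij := h.orthogonal _ _ (f.injective.ne hij)
  sum_identity := by
    have := h.sum_identity
    rwa [← f.sum_comp] at this
  eq_sum := by
    rw [h.eq_sum, ← f.sum_comp]
    rfl

lemma restrict (h : IsIdempotentDecomposition x p lam) [DecidablePred fun i => p i ≠ 0] :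
    IsIdempotentDecomposition x (fun i : {i // p i ≠ 0} => p i) (fun i => lam i) where
  idem i := h.idem _
  orthogonal i j hij := h.orthogonal _ _ (fun h => hij (Subtype.ext h))
  sum_identity := by
    have := h.sum_identity
    rwa [← Finset.sum_filter_add_sum_filter_not _ (fun i => p i ≠ 0),
      Finset.sum_eq_zero (s := Finset.univ.filter fun i => ¬ p i ≠ 0) (by simp), add_zero,
      ← Finset.sum_subtype_eq_sum_filter, Finset.subtype_univ] at this
  eq_sum := by
    rw [h.eq_sum, ← Finset.sum_filter_add_sum_filter_not _ (fun i => p i ≠ 0),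
      Finset.sum_eq_zero (s := Finset.univ.filter fun i => ¬ p i ≠ 0)
        (fun i hi => by simp at hi; simp [hi]), add_zero,
      ← Finset.sum_subtype_eq_sum_filter, Finset.subtype_univ]

lemma card_le [FiniteDimensional ℝ J] (h : IsIdempotentDecomposition x p lam)
    (hne : ∀ i, p i ≠ 0) : Fintype.card ι ≤ Module.finrank ℝ J := by
  refine LinearIndependent.fintype_card_le_finrank (R := ℝ) (b := p) ?_
  rw [Fintype.linearIndependent_iff]
  intro g hg i
  have := sum_smul_mul h.idem h.orthogonal g i
  rw [hg, jzero_mul] at this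
  exact (smul_eq_zero.1 this.symm).resolve_right (hne i)

end IsIdempotentDecomposition

variable [IsCommJordan J] [FiniteDimensional ℝ J]

lemma FormallyReal.exists_isIdempotentDecomposition (hreal : FormallyReal J) {e : J}
    (he : IsIdentity e) (x : J) :
    ∃ (r : ℕ) (p : Fin r → J) (lam : Fin r → ℝ), IsIdempotentDecomposition x p lam ∧
      ∀ i, p i ≠ 0 := by
  classical
  obtain ⟨S, p, hx, hidem, horth, -⟩ := hreal.exists_idempotent_decomposition x
  have h1 : ∀ a ∈ S, p a * (∑ b ∈ S, p b) = p a := fun a ha => by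
    rw [jmul_sum, Finset.sum_eq_single_of_mem a ha (fun b hb hba => horth a ha b hb hba.symm),
      hidem a ha]
  have h2 : (∑ b ∈ S, p b) * (∑ b ∈ S, p b) = ∑ b ∈ S, p b := by
    rw [jsum_mul]; exact Finset.sum_congr rfl h1
  -- `none` carries the complementary idempotent, with eigenvalue 0; vanishing idempotents are
  -- dropped at the end.
  have key : IsIdempotentDecomposition x
      (fun o : Option S => o.elim (e - ∑ b ∈ S, p b) (fun a => p a))
      (fun o : Option S => o.elim 0 (fun a => (a : ℝ))) := by
    refine ⟨?_, ?_, ?_, ?_⟩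
    · rintro (_ | a)
      · simp only [Option.elim_none, jsub_mul, jmul_sub, he _, he.mul_right, h2]
        abel
      · exact hidem _ a.2
    · rintro (_ | a) (_ | b) hab
      · exact absurd rfl hab
      · simp only [Option.elim_none, Option.elim_some]
        rw [mul_comm, jmul_sub, he.mul_right, h1 b b.2, sub_self]
      · simp only [Option.elim_none, Option.elim_some]
        rw [jmul_sub, he.mul_right, h1 a a.2, sub_self]
      · exact horth _ a.2 _ b.2 (fun h => hab (by rw [Subtype.ext h]))
    · rw [Fintype.sum_option]
      simp only [Option.elim_none, Option.elim_some]
      rw [Finset.sum_coe_sort S p, sub_add_cancel]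
      exact he
    · rw [Fintype.sum_option]
      simp only [Option.elim_none, Option.elim_some]
      rw [Finset.sum_coe_sort S (fun a => a • p a), zero_smul, zero_add]
      exact hx
  exact ⟨_, _, _, key.restrict.reindex (Fintype.equivFin _).symm, fun i => ((Fintype.equivFin _).symm i).2⟩

/-- The spectral theorem. -/
theorem FormallyReal.exists_isSpectralDecomposition (hreal : FormallyReal J) (x : J) :
    ∃ (r : ℕ) (p : Fin r → J) (lam : Fin r → ℝ), IsSpectralDecomposition x p lam := by
  have hT := hreal.isTraceForm_traceL
  obtain ⟨e, he⟩ := hT.exists_identity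
  -- Primitivity comes from maximal length: lengths are bounded by dim J, and splitting some p_i
  -- would lengthen the decomposition.
  let A : Set ℕ := {r | ∃ (p : Fin r → J) (lam : Fin r → ℝ), IsIdempotentDecomposition x p lam ∧
      ∀ i, p i ≠ 0}
  have hA : A.Nonempty := hreal.exists_isIdempotentDecomposition he x
  have hbdd : BddAbove A := ⟨Module.finrank ℝ J, by
    rintro r ⟨p, lam, h, h0⟩
    simpa using h.card_le h0⟩
  obtain ⟨r, ⟨p, lam, h, h0⟩, hmax⟩ : ∃ r ∈ A, ∀ s ∈ A, s ≤ r :=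
    ⟨sSup A, Nat.sSup_mem hA hbdd, fun s hs => le_csSup hbdd hs⟩
  refine ⟨_, p, lam, ⟨fun i => ⟨h.idem i, h0 i, ?_⟩, h.orthogonal, h.sum_identity⟩, h.eq_sum⟩
  intro q q' hq hq' hqq hpi
  by_contra! hne
  -- T(p_j q²) + T(p_j q'²) = T(p_j p_i) = 0, and both terms are nonnegative.
  have horth : ∀ j, j ≠ i → p j * q = 0 ∧ p j * q' = 0 := by
    intro j hj
    have h1 := h.orthogonal j i hj
    rw [hpi, mul_add] at h1
    have h2 := congrArg (traceL J) h1
    rw [map_add, map_zero, ← hq, ← hq'] at h2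
    have h3 := hT.idempotent_nonneg (h.idem j) q
    have h4 := hT.idempotent_nonneg (h.idem j) q'
    exact ⟨hT.mul_eq_zero_of_idempotent (h.idem j) (by linarith),
      hT.mul_eq_zero_of_idempotent (h.idem j) (by linarith)⟩
  have hsum : ∀ mu : Fin r → ℝ, mu i • q' + ∑ j, mu j • (if j = i then q else p j) =
      ∑ j, mu j • p j := by
    intro mu
    rw [← Finset.add_sum_erase _ _ (Finset.mem_univ i),
      ← Finset.add_sum_erase (a := i) _ (fun j => mu j • p j) (Finset.mem_univ i), if_pos rfl,
      ← add_assoc, hpi, ← smul_add, add_comm q']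
    congr 1
    refine Finset.sum_congr rfl fun j hj => ?_
    rw [if_neg (Finset.ne_of_mem_erase hj)]
  have key : IsIdempotentDecomposition x
      (fun o : Option (Fin r) => o.elim q' (fun j => if j = i then q else p j))
      (fun o : Option (Fin r) => o.elim (lam i) lam) := by
    refine ⟨?_, ?_, ?_, ?_⟩
    · rintro (_ | j)
      · exact hq'
      · by_cases hj : j = i
        · simp only [Option.elim_some, if_pos hj, hq]
        · simp only [Option.elim_some, if_neg hj, h.idem]
    · rintro (_ | j) (_ | k) hjk
      · exact absurd rfl hjk
      · by_cases hk : k = i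
        · simp only [Option.elim_some, Option.elim_none, if_pos hk]
          rw [mul_comm, hqq]
        · simp only [Option.elim_some, Option.elim_none, if_neg hk]
          rw [mul_comm, (horth k hk).2]
      · by_cases hj : j = i
        · simp only [Option.elim_some, Option.elim_none, if_pos hj, hqq]
        · simp only [Option.elim_some, Option.elim_none, if_neg hj, (horth j hj).2]
      · have hjk' : j ≠ k := fun h => hjk (by rw [h])
        by_cases hj : j = i
        · have hk : k ≠ i := fun h => hjk' (by rw [hj, h])
          simp only [Option.elim_some, if_pos hj, if_neg hk]
          rw [mul_comm, (horth k hk).1]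
        · by_cases hk : k = i
          · simp only [Option.elim_some, if_neg hj, if_pos hk, (horth j hj).1]
          · simp only [Option.elim_some, if_neg hj, if_neg hk, h.orthogonal j k hjk']
    · rw [Fintype.sum_option]
      have := hsum (fun _ => 1)
      simp only [one_smul] at this
      simp only [Option.elim_none, Option.elim_some]
      rw [this]
      exact h.sum_identity
    · rw [Fintype.sum_option]
      simp only [Option.elim_none, Option.elim_some]
      rw [hsum, h.eq_sum]
  have hmem : r + 1 ∈ A := ⟨_, _, key.reindex (finSuccEquiv r), fun j => by
    rcases hj : finSuccEquiv r j with _ | k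
    · simpa [hj] using hne.2
    · by_cases hk : k = i
      · simpa [hj, hk] using hne.1
      · simpa [hj, hk] using h0 k⟩
  exact absurd (hmax _ hmem) (by omega)

namespace IsJordanFrame

variable {r : ℕ} {p : Fin r → J}

lemma idem (h : IsJordanFrame p) (i : Fin r) : p i * p i = p i := (h.primitive i).mul_self

lemma sum_mul_sum (h : IsJordanFrame p) (lam mu : Fin r → ℝ) :
    (∑ i, lam i • p i) * (∑ i, mu i • p i) = ∑ i, (lam i * mu i) • p i :=
  sum_smul_mul_sum_smul h.idem h.orthogonal lam mu

lemma sum_mul (h : IsJordanFrame p) (lam : Fin r → ℝ) (i : Fin r) :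
    (∑ i, lam i • p i) * p i = lam i • p i :=
  sum_smul_mul h.idem h.orthogonal lam i

lemma sum_eq (h : IsJordanFrame p) {e : J} (he : IsIdentity e) : ∑ i, p i = e :=
  h.sum_identity.unique he

lemma P_sum (h : IsJordanFrame p) (lam mu : Fin r → ℝ) :
    P (∑ i, lam i • p i) (∑ i, mu i • p i) = ∑ i, (lam i ^ 2 * mu i) • p i := by
  rw [P_apply, h.sum_mul_sum, h.sum_mul_sum, h.sum_mul_sum, h.sum_mul_sum, Finset.smul_sum,
    ← Finset.sum_sub_distrib]
  refine Finset.sum_congr rfl fun i _ => ?_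
  rw [smul_smul, ← sub_smul]
  ring_nf

lemma P_sum_apply (h : IsJordanFrame p) (lam : Fin r → ℝ) (i : Fin r) :
    P (∑ i, lam i • p i) (p i) = lam i ^ 2 • p i := by
  rw [P_apply, h.sum_mul_sum, h.sum_mul, h.sum_mul, mul_smul_comm, h.sum_mul, smul_smul, smul_smul,
    ← sub_smul]
  ring_nf

lemma mem_symmetricCone (h : IsJordanFrame p) {lam : Fin r → ℝ} (hlam : ∀ i, 0 < lam i) :
    ∑ i, lam i • p i ∈ symmetricCone J := ⟨r, p, lam, ⟨h, rfl⟩, hlam⟩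

end IsJordanFrame

/-- Self-duality of the symmetric cone. -/
lemma IsTraceForm.mem_symmetricCone_iff {T : J →ₗ[ℝ] ℝ} (hT : IsTraceForm T)
    (hreal : FormallyReal J) {x : J} :
    x ∈ symmetricCone J ↔ ∀ y : J, y ≠ 0 → 0 < T (x * (y * y)) := by
  constructor
  · rintro ⟨r, p, lam, ⟨hp, rfl⟩, hlam⟩ y hy
    rw [jsum_mul, map_sum]
    simp only [smul_mul_assoc, map_smul, smul_eq_mul]
    have hsum : T (y * y) = ∑ i, T (p i * (y * y)) := by
      rw [← map_sum, ← jsum_mul, hp.sum_identity]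
    have hpos := hT.pos y hy
    obtain ⟨i, -, hi⟩ : ∃ i ∈ Finset.univ, 0 < T (p i * (y * y)) := by
      by_contra! h
      exact (Finset.sum_nonpos h).not_gt (hsum ▸ hpos)
    exact Finset.sum_pos' (fun j _ => mul_nonneg (hlam j).le (hT.idempotent_nonneg (hp.idem j) y))
      ⟨i, Finset.mem_univ i, mul_pos (hlam i) hi⟩
  · intro h
    obtain ⟨r, p, lam, hp, rfl⟩ := hreal.exists_isSpectralDecomposition x
    refine hp.mem_symmetricCone fun i => ?_
    have h1 := h (p i) (hp.primitive i).ne_zero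
    rw [hp.idem, hp.sum_mul, map_smul, smul_eq_mul] at h1
    have h2 := hT.pos (p i) (hp.primitive i).ne_zero
    rw [hp.idem] at h2
    exact (mul_pos_iff_of_pos_right h2).1 h1

/-- Meant for limits of cone elements: their eigenvalues are nonnegative, and P(x) p_i = λ_i² p_i
rules out 0 when P(x) is injective. -/
lemma IsTraceForm.mem_symmetricCone_of_nonneg {T : J →ₗ[ℝ] ℝ} (hT : IsTraceForm T)
    (hreal : FormallyReal J) {x : J} (h : ∀ y : J, 0 ≤ T (x * (y * y)))
    (hinj : Function.Injective (P x)) : x ∈ symmetricCone J := by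
  obtain ⟨r, p, lam, hp, rfl⟩ := hreal.exists_isSpectralDecomposition x
  refine hp.mem_symmetricCone fun i => ?_
  have h1 := h (p i)
  rw [hp.idem, hp.sum_mul, map_smul, smul_eq_mul] at h1
  have h2 := hT.pos (p i) (hp.primitive i).ne_zero
  rw [hp.idem] at h2
  refine lt_of_le_of_ne (nonneg_of_mul_nonneg_left h1 h2) fun h0 => ?_
  refine (hp.primitive i).ne_zero (hinj ?_)
  rw [hp.P_sum_apply, ← h0, map_zero]
  simp

lemma FormallyReal.pos_of_sum_mem (hreal : FormallyReal J) {r : ℕ} {p : Fin r → J}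
    (hp : IsJordanFrame p) {lam : Fin r → ℝ} (h : ∑ i, lam i • p i ∈ symmetricCone J) (i : Fin r) :
    0 < lam i := by
  have hT := hreal.isTraceForm_traceL
  have h1 := (hT.mem_symmetricCone_iff hreal).1 h (p i) (hp.primitive i).ne_zero
  rw [hp.idem, hp.sum_mul, map_smul, smul_eq_mul] at h1
  exact (mul_pos_iff_of_pos_right
    (traceL_idempotent_pos (hp.idem i) (hp.primitive i).ne_zero)).1 h1

/-- The Peirce `1`-space of a primitive idempotent is one-dimensional. -/
lemma FormallyReal.eq_smul_of_primitive (hreal : FormallyReal J) {p u : J}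
    (hp : IsPrimitiveIdempotent p) (hu : p * u = u) : ∃ c : ℝ, u = c • p := by
  obtain ⟨S, q, hq, hidem, -, hev⟩ := hreal.exists_idempotent_decomposition u
  -- L(u) commutes with L(p), so the Peirce 1-space of p is stable under L(u) and contains the
  -- spectral idempotents of u. Primitivity of p then leaves only 0 and p.
  have hqp : ∀ a ∈ S, p * q a = q a := by
    intro a ha
    obtain ⟨f, hf⟩ := hev a ha
    have := evalMul_mem (x := u) (V := LinearMap.ker (L p - 1))
      (by simp [L_apply, hu]) (fun y hy => by
        rw [LinearMap.mem_ker, LinearMap.sub_apply, Module.End.one_apply, L_apply,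
          sub_eq_zero] at hy ⊢
        have := congrArg (fun A : Module.End ℝ J => A y) (commute_of_mul_eq hp.mul_self hu)
        simp only [Module.End.mul_apply, L_apply] at this
        rw [← this, hy]) f
    rwa [← hf, LinearMap.mem_ker, LinearMap.sub_apply, Module.End.one_apply, L_apply,
      sub_eq_zero] at this
  have : u ∈ Submodule.span ℝ {p} := by
    rw [hq]
    refine Submodule.sum_mem _ fun a ha => Submodule.smul_mem _ _ ?_
    have h1 := hqp a ha
    have h2 := hidem a ha
    rcases hp.indecomposable (q a) (p - q a) h2 (by
      rw [jsub_mul, jmul_sub, jmul_sub, hp.mul_self, h1, mul_comm _ p, h1, h2, sub_self, sub_zero])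
      (by rw [jmul_sub, mul_comm, h1, h2, sub_self]) (by abel) with h | h
    · rw [h]; exact Submodule.zero_mem _
    · rw [← sub_eq_zero.1 h]; exact Submodule.mem_span_singleton_self p
  obtain ⟨c, hc⟩ := Submodule.mem_span_singleton.1 this
  exact ⟨c, hc.symm⟩

end Frames

/-! ### The groups exp(tL(v)), the fundamental formula, and invariance of the cone. -/

section Analysis

variable {J : Type*} [NormedAddCommGroup J] [NormedSpace ℝ J] [CommMagma J]
  [LeftDistribClass J] [SMulCommClass ℝ J J] [FiniteDimensional ℝ J]

variable (J) in
/-- The Jordan product as a continuous bilinear map. -/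
def mulCLM : J →L[ℝ] J →L[ℝ] J :=
  LinearMap.toContinuousLinearMap
    ((LinearMap.toContinuousLinearMap (E := J) (F' := J)).toLinearMap.comp (mulMap J))

lemma mulCLM_apply (x y : J) : mulCLM J x y = x * y := rfl

instance : ContinuousMul J :=
  ⟨(mulCLM J).continuous₂⟩

lemma hasDerivAt_jmul {f g : ℝ → J} {f' g' : J} {t : ℝ} (hf : HasDerivAt f f' t)
    (hg : HasDerivAt g g' t) : HasDerivAt (fun s => f s * g s) (f t * g' + f' * g t) t :=
  (mulCLM J).hasDerivAt_of_bilinear (fun _ => hf) (fun _ => hg)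

/-- The quadratic representation as a continuous linear map. -/
def PCLM (x : J) : J →L[ℝ] J := (2 : ℝ) • (mulCLM J x * mulCLM J x) - mulCLM J (x * x)

lemma PCLM_apply (x y : J) : PCLM x y = P x y := rfl

lemma continuous_PCLM : Continuous (PCLM : J → J →L[ℝ] J) := by
  unfold PCLM
  fun_prop

lemma hasDerivAt_PCLM {u : ℝ → J} {u' : J} {t : ℝ} (hu : HasDerivAt u u' t) :
    HasDerivAt (fun s => PCLM (u s)) ((2 : ℝ) • (mulCLM J (u t) * mulCLM J u' +
      mulCLM J u' * mulCLM J (u t) - mulCLM J (u t * u'))) t := by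
  have h1 : HasDerivAt (fun s => mulCLM J (u s)) (mulCLM J u') t :=
    (mulCLM J).hasFDerivAt.comp_hasDerivAt t hu
  have h2 : HasDerivAt (fun s => mulCLM J (u s * u s)) (mulCLM J (u t * u' + u' * u t)) t :=
    (mulCLM J).hasFDerivAt.comp_hasDerivAt t (hasDerivAt_jmul hu hu)
  refine (((h1.mul h1).const_smul (2 : ℝ)).sub h2).congr_deriv ?_
  rw [mul_comm u' (u t), map_add]
  module

/-- The one-parameter group `exp (t L(v))`. -/
def expL (v : J) (t : ℝ) : J →L[ℝ] J := NormedSpace.exp (t • mulCLM J v)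

lemma expL_zero (v : J) : expL v 0 = 1 := by
  rw [expL, zero_smul, NormedSpace.exp_zero]

lemma expL_add (v : J) (s t : ℝ) : expL v (s + t) = expL v s * expL v t := by
  let _ : NormedAlgebra ℚ (J →L[ℝ] J) := NormedAlgebra.restrictScalars ℚ ℝ _
  rw [expL, add_smul, NormedSpace.exp_add_of_commute]
  · rfl
  · exact ((Commute.refl _).smul_left s).smul_right t

lemma expL_mul_neg (v : J) (t : ℝ) : expL v t * expL v (-t) = 1 := by
  rw [← expL_add, add_neg_cancel, expL_zero]

lemma expL_neg_mul (v : J) (t : ℝ) : expL v (-t) * expL v t = 1 := by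
  rw [← expL_add, neg_add_cancel, expL_zero]

lemma hasDerivAt_expL (v : J) (t : ℝ) : HasDerivAt (expL v) (mulCLM J v * expL v t) t :=
  hasDerivAt_exp_smul_const' (𝕂 := ℝ) (mulCLM J v) t

lemma hasDerivAt_expL' (v : J) (t : ℝ) : HasDerivAt (expL v) (expL v t * mulCLM J v) t :=
  hasDerivAt_exp_smul_const (𝕂 := ℝ) (mulCLM J v) t

lemma hasDerivAt_expL_neg (v : J) (t : ℝ) :
    HasDerivAt (fun s => expL v (-s)) (-(mulCLM J v * expL v (-t))) t := by
  exact ((hasDerivAt_expL v (-t)).scomp t (hasDerivAt_neg t)).congr_deriv (by simp)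

lemma hasDerivAt_expL_neg' (v : J) (t : ℝ) :
    HasDerivAt (fun s => expL v (-s)) (-(expL v (-t) * mulCLM J v)) t := by
  exact ((hasDerivAt_expL' v (-t)).scomp t (hasDerivAt_neg t)).congr_deriv (by simp)

lemma eq_of_hasDerivAt_zero {E : Type*} [NormedAddCommGroup E] [NormedSpace ℝ E] {f : ℝ → E}
    (h : ∀ t, HasDerivAt f 0 t) (s t : ℝ) : f s = f t :=
  is_const_of_deriv_eq_zero (fun t => (h t).differentiableAt) (fun t => (h t).deriv) s t

lemma hasDerivAt_expL_apply (v y : J) (t : ℝ) :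
    HasDerivAt (fun s => expL v s y) (v * expL v t y) t := by
  simpa [mulCLM_apply] using (hasDerivAt_expL v t).clm_apply (hasDerivAt_const t y)

lemma hasDerivAt_sum_smul {r : ℕ} {p : Fin r → J} {f f' : Fin r → ℝ → ℝ} {t : ℝ}
    (h : ∀ i, HasDerivAt (f i) (f' i t) t) :
    HasDerivAt (fun s => ∑ i, f i s • p i) (∑ i, f' i t • p i) t :=
  HasDerivAt.fun_sum fun i _ => (h i).smul_const (p i)

lemma hasDerivAt_exp_mul (a t : ℝ) :
    HasDerivAt (fun s => Real.exp (s * a)) (a * Real.exp (t * a)) t := by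
  simpa [mul_comm] using ((hasDerivAt_id t).mul_const a).exp

lemma hasDerivAt_frame_exp {r : ℕ} {p : Fin r → J} (lam : Fin r → ℝ) (t : ℝ) :
    HasDerivAt (fun s => ∑ i, Real.exp (s * lam i) • p i)
      (∑ i, (lam i * Real.exp (t * lam i)) • p i) t :=
  hasDerivAt_sum_smul (f := fun i s => Real.exp (s * lam i))
    (f' := fun i s => lam i * Real.exp (s * lam i)) fun i => hasDerivAt_exp_mul (lam i) t

variable [IsCommJordan J]

/-- By `P_derivation`, conjugating back by exp(-tL(v)) gives a quantity constant in t. At y = e this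
reads P(exp v) = exp(L(v))², which makes every P(a) with a in the cone a square of such operators.
-/
lemma PCLM_expL (v y : J) (t : ℝ) :
    PCLM (expL v t y) = expL v t * PCLM y * expL v t := by
  have key : ∀ t, HasDerivAt (fun s => expL v (-s) * PCLM (expL v s y) * expL v (-s)) 0 t := by
    intro t
    refine (((hasDerivAt_expL_neg' v t).fun_mul (hasDerivAt_PCLM (hasDerivAt_expL_apply v y t))).fun_mul
      (hasDerivAt_expL_neg v t)).congr_deriv ?_
    have h : (2 : ℝ) • (mulCLM J (expL v t y) * mulCLM J (v * expL v t y) +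
        mulCLM J (v * expL v t y) * mulCLM J (expL v t y) -
        mulCLM J (expL v t y * (v * expL v t y))) =
        mulCLM J v * PCLM (expL v t y) + PCLM (expL v t y) * mulCLM J v := by
      ext z
      exact congrArg (fun A : Module.End ℝ J => A z) (P_derivation v (expL v t y))
    rw [h]
    noncomm_ring
  have h := eq_of_hasDerivAt_zero key t 0
  simp only [neg_zero, expL_zero, one_mul, mul_one, one_apply_eq_self] at h
  rw [← h]
  calc PCLM (expL v t y) = (expL v t * expL v (-t)) * PCLM (expL v t y) *
        (expL v (-t) * expL v t) := by rw [expL_mul_neg, expL_neg_mul, one_mul, mul_one]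
    _ = _ := by noncomm_ring

lemma IsJordanFrame.expL_apply {r : ℕ} {p : Fin r → J} (hp : IsJordanFrame p) {e : J}
    (he : IsIdentity e) (lam : Fin r → ℝ) (t : ℝ) :
    expL (∑ i, lam i • p i) t e = ∑ i, Real.exp (t * lam i) • p i := by
  set v := ∑ i, lam i • p i with hv
  have key : ∀ t, HasDerivAt (fun s => expL v (-s) (∑ i, Real.exp (s * lam i) • p i)) 0 t := by
    intro t
    refine ((hasDerivAt_expL_neg' v t).clm_apply (hasDerivAt_frame_exp lam t)).congr_deriv ?_
    rw [← hp.sum_mul_sum, ← hv, neg_apply, mul_apply_eq_comp, mulCLM_apply,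
      neg_add_cancel]
  have h := eq_of_hasDerivAt_zero key t 0
  simp only [neg_zero, expL_zero, zero_mul, Real.exp_zero, one_smul, hp.sum_eq he,
    one_apply_eq_self] at h
  rw [← h, ← mul_apply_eq_comp, expL_mul_neg, one_apply_eq_self]

/-- By homogeneity the inequality of self-duality need only be tested on the unit sphere, and
compactness makes it an open condition. -/
lemma IsTraceForm.isOpen_symmetricCone {T : J →ₗ[ℝ] ℝ} (hT : IsTraceForm T)
    (hreal : FormallyReal J) : IsOpen (symmetricCone J) := by
  have hTc : Continuous T := T.continuous_of_finiteDimensional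
  rw [isOpen_iff_eventually]
  intro x hx
  have h1 : ∀ᶠ z in nhds x, ∀ y ∈ Metric.sphere (0 : J) 1, 0 < T (z * (y * y)) := by
    refine (isCompact_sphere (0 : J) 1).eventually_forall_of_forall_eventually fun y hy => ?_
    have hy0 : y ≠ 0 := by
      rintro rfl
      simp at hy
    have hc : Continuous fun z : J × J => T (z.1 * (z.2 * z.2)) := by fun_prop
    exact hc.continuousAt.eventually (lt_mem_nhds ((hT.mem_symmetricCone_iff hreal).1 hx y hy0))
  filter_upwards [h1] with z hz
  rw [hT.mem_symmetricCone_iff hreal]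
  intro y hy
  have h2 := hz (‖y‖⁻¹ • y) (by simp [norm_smul, hy])
  simp only [smul_mul_assoc, mul_smul_comm, map_smul, smul_eq_mul] at h2
  have h3 : 0 < ‖y‖⁻¹ := by positivity
  exact (mul_pos_iff_of_pos_left h3).1 ((mul_pos_iff_of_pos_left h3).1 h2)

lemma exists_expL {e : J} (he : IsIdentity e) {a : J}
    (ha : a ∈ symmetricCone J) : ∃ v : J, a = expL v 1 e := by
  obtain ⟨r, p, lam, ⟨hp, rfl⟩, hlam⟩ := ha
  refine ⟨∑ i, Real.log (lam i) • p i, ?_⟩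
  rw [hp.expL_apply he]
  exact Finset.sum_congr rfl fun i _ => by rw [one_mul, Real.exp_log (hlam i)]

lemma expL_injective (v : J) (t : ℝ) : Function.Injective (expL v t) := by
  intro x y h
  have := congrArg (expL v (-t)) h
  simpa only [← mul_apply_eq_comp, expL_neg_mul, one_apply_eq_self]
    using this

lemma PCLM_identity {e : J} (he : IsIdentity e) : PCLM e = 1 := by
  ext y
  rw [PCLM_apply, he.P_eq]; rfl

lemma PCLM_expL_identity {e : J} (he : IsIdentity e) (v : J) (t : ℝ) :
    PCLM (expL v t e) = expL v t * expL v t := by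
  rw [PCLM_expL, PCLM_identity he, mul_one]

lemma FormallyReal.P_injective (hreal : FormallyReal J) {a : J} (ha : a ∈ symmetricCone J) :
    Function.Injective (P a) := by
  obtain ⟨e, he⟩ := hreal.isTraceForm_traceL.exists_identity
  obtain ⟨v, rfl⟩ := exists_expL he ha
  change Function.Injective (PCLM (expL v 1 e))
  rw [PCLM_expL_identity he]
  exact (expL_injective v 1).comp (expL_injective v 1)

/-- Connectedness of ℝ: the times at which the orbit lies in the cone form an open set, which is
also closed because P stays injective along the orbit by `PCLM_expL`. -/
lemma FormallyReal.expL_mem (hreal : FormallyReal J) {y : J}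
    (hy : y ∈ symmetricCone J) (v : J) (t : ℝ) : expL v t y ∈ symmetricCone J := by
  have hT := hreal.isTraceForm_traceL
  have hTc : Continuous (traceL J) := (traceL J).continuous_of_finiteDimensional
  have hc : Continuous fun t => expL v t y :=
    continuous_iff_continuousAt.2 fun t => (hasDerivAt_expL_apply v y t).continuousAt
  let S : Set ℝ := {t | expL v t y ∈ symmetricCone J}
  have hopen : IsOpen S := (hT.isOpen_symmetricCone hreal).preimage hc
  have hclosed : IsClosed S := by
    refine isClosed_of_closure_subset fun t ht => ?_
    refine hT.mem_symmetricCone_of_nonneg hreal (fun z => ?_) ?_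
    · have hcl : IsClosed {t | 0 ≤ traceL J (expL v t y * (z * z))} :=
        isClosed_le continuous_const (by fun_prop)
      refine closure_minimal (fun s hs => ?_) hcl ht
      by_cases hz : z = 0
      · simp [hz, jmul_zero]
      · exact ((hT.mem_symmetricCone_iff hreal).1 hs z hz).le
    · change Function.Injective (PCLM (expL v t y))
      rw [PCLM_expL]
      exact ((expL_injective v t).comp (hreal.P_injective hy)).comp (expL_injective v t)
  have huniv : S = Set.univ := IsClopen.eq_univ ⟨hclosed, hopen⟩ ⟨0, by
    change expL v 0 y ∈ symmetricCone J
    rwa [expL_zero]⟩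
  have : t ∈ S := by rw [huniv]; trivial
  exact this

lemma FormallyReal.P_mem (hreal : FormallyReal J) {a y : J} (ha : a ∈ symmetricCone J)
    (hy : y ∈ symmetricCone J) : P a y ∈ symmetricCone J := by
  obtain ⟨e, he⟩ := hreal.isTraceForm_traceL.exists_identity
  obtain ⟨v, rfl⟩ := exists_expL he ha
  rw [← PCLM_apply, PCLM_expL_identity he]
  exact hreal.expL_mem (hreal.expL_mem hy v 1) v 1

/-- The fundamental formula on the symmetric cone. -/
lemma FormallyReal.PCLM_PCLM_of_mem (hreal : FormallyReal J) {a : J} (ha : a ∈ symmetricCone J)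
    (y : J) : PCLM (PCLM a y) = PCLM a * PCLM y * PCLM a := by
  obtain ⟨e, he⟩ := hreal.isTraceForm_traceL.exists_identity
  obtain ⟨v, rfl⟩ := exists_expL he ha
  rw [PCLM_expL_identity he, mul_apply_eq_comp, PCLM_expL, PCLM_expL]
  noncomm_ring

lemma FormallyReal.identity_mem (hreal : FormallyReal J) {e : J} (he : IsIdentity e) :
    e ∈ symmetricCone J := by
  obtain ⟨r, p, lam, hp, -⟩ := hreal.exists_isSpectralDecomposition e
  rw [← hp.sum_eq he]
  simpa using hp.mem_symmetricCone (lam := fun _ => 1) fun _ => one_pos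

lemma FormallyReal.idempotent_add_mem (hreal : FormallyReal J) {e : J} (he : IsIdentity e)
    {p : J} (hp : p * p = p) {c : ℝ} (hc : 0 < c) : p + c • e ∈ symmetricCone J := by
  have hT := hreal.isTraceForm_traceL
  rw [hT.mem_symmetricCone_iff hreal]
  intro y hy
  rw [add_mul, map_add, smul_mul_assoc, he, map_smul, smul_eq_mul]
  have h1 := hT.idempotent_nonneg hp y
  have h2 := hT.pos y hy
  positivity

/-- The fundamental formula for idempotents. -/
lemma FormallyReal.PCLM_PCLM_of_idempotent (hreal : FormallyReal J) {p : J} (hp : p * p = p)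
    (y : J) : PCLM (PCLM p y) = PCLM p * PCLM y * PCLM p := by
  obtain ⟨e, he⟩ := hreal.isTraceForm_traceL.exists_identity
  have hc := continuous_PCLM (J := J)
  have h1 : Filter.Tendsto (fun c : ℝ => p + c • e) (nhdsWithin 0 (Set.Ioi 0)) (nhds p) := by
    have : Filter.Tendsto (fun c : ℝ => p + c • e) (nhds 0) (nhds (p + (0 : ℝ) • e)) :=
      (Continuous.tendsto (by fun_prop) 0)
    rw [zero_smul, add_zero] at this
    exact this.mono_left nhdsWithin_le_nhds
  have hl : Continuous fun a : J => PCLM (PCLM a y) := by fun_prop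
  have hr : Continuous fun a : J => PCLM a * PCLM y * PCLM a := by fun_prop
  refine tendsto_nhds_unique_of_eventuallyEq ((hl.tendsto p).comp h1) ((hr.tendsto p).comp h1) ?_
  filter_upwards [self_mem_nhdsWithin] with c hc'
  exact hreal.PCLM_PCLM_of_mem (hreal.idempotent_add_mem he hp hc') y

end Analysis

/-! ### Linearity and associativity of the eigenvalue trace. -/

section JordanTrace

variable {J : Type*} [NormedAddCommGroup J] [NormedSpace ℝ J] [CommMagma J]
  [LeftDistribClass J] [SMulCommClass ℝ J J] [FiniteDimensional ℝ J] [IsCommJordan J]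

lemma FormallyReal.exists_P_eq_smul (hreal : FormallyReal J) {p : J}
    (hp : IsPrimitiveIdempotent p) (y : J) : ∃ c : ℝ, P p y = c • p := by
  refine hreal.eq_smul_of_primitive hp ?_
  exact congrArg (fun A : Module.End ℝ J => A y) (L_mul_P_idempotent hp.mul_self)

/-- Write τ = Tr L, P(p)q = a p and P(q)p = b q. Then a τ(p) = τ(pq) = b τ(q), and the fundamental
formula P(P(p)q) = P(p)P(q)P(p) at e gives a² = ab. So either a = 0 and pq = 0, or a = b. -/
lemma FormallyReal.orthogonal_or_traceL_eq (hreal : FormallyReal J) {p q : J}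
    (hp : IsPrimitiveIdempotent p) (hq : IsPrimitiveIdempotent q) :
    p * q = 0 ∨ traceL J p = traceL J q := by
  have hT := hreal.isTraceForm_traceL
  obtain ⟨e, he⟩ := hT.exists_identity
  obtain ⟨a, ha⟩ := hreal.exists_P_eq_smul hp q
  obtain ⟨b, hb⟩ := hreal.exists_P_eq_smul hq p
  have htr : ∀ u v : J, u * u = u → traceL J (P u v) = traceL J (u * v) := by
    intro u v hu
    rw [← he.mul_right (P u v), hT.P_symm, he.P_apply_self, hu, mul_comm]
  have h1 : a * traceL J p = traceL J (p * q) := by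
    rw [← htr p q hp.mul_self, ha, map_smul, smul_eq_mul]
  have h2 : b * traceL J q = traceL J (p * q) := by
    rw [mul_comm p q, ← htr q p hq.mul_self, hb, map_smul, smul_eq_mul]
  have h3 : (a * a) • p = (b * a) • p := by
    have := congrArg (fun A : J →L[ℝ] J => A e) (hreal.PCLM_PCLM_of_idempotent hp.mul_self q)
    simp only [mul_apply_eq_comp, PCLM_apply, he.P_apply_self, hp.mul_self, ha, hb, map_smul,
      smul_mul_assoc, mul_smul_comm, smul_smul] at this
    exact this
  have h4 : a * a = b * a := smul_left_injective ℝ hp.ne_zero h3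
  by_cases ha0 : a = 0
  · left
    refine hT.mul_eq_zero_of_idempotent hp.mul_self ?_
    rw [hq.mul_self, ← h1, ha0, zero_mul]
  · right
    have hab : a = b := mul_right_cancel₀ ha0 h4
    rw [← h2, ← hab] at h1
    exact mul_left_cancel₀ ha0 h1

/-- The trace of the algebra is a linear associative positive definite functional. -/
theorem FormallyReal.exists_isTraceForm_jtrace (hreal : FormallyReal J) :
    ∃ T : J →ₗ[ℝ] ℝ, IsTraceForm T ∧ ∀ x, jtrace x = T x := by
  have hT := hreal.isTraceForm_traceL
  obtain ⟨r, c, -, hc, -⟩ := hreal.exists_isSpectralDecomposition (0 : J)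
  -- Multiplication by z acts on each primitive p as the scalar 1/τ(p), since every c_i not
  -- orthogonal to p has τ(c_i) = τ(p). Hence x ↦ τ(xz) is 1 on all primitive idempotents.
  set z : J := ∑ i, (traceL J (c i))⁻¹ • c i with hz
  have hpos : ∀ {p : J}, IsPrimitiveIdempotent p → traceL J p ≠ 0 := fun hp =>
    (traceL_idempotent_pos hp.mul_self hp.ne_zero).ne'
  have hzp : ∀ {p : J}, IsPrimitiveIdempotent p → p * z = (traceL J p)⁻¹ • p := by
    intro p hp
    rw [mul_comm]
    nth_rewrite 3 [← hc.sum_identity p]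
    rw [hz, jsum_mul, jsum_mul, Finset.smul_sum]
    refine Finset.sum_congr rfl fun i _ => ?_
    rw [smul_mul_assoc]
    rcases hreal.orthogonal_or_traceL_eq (hc.primitive i) hp with h | h
    · rw [h, smul_zero, smul_zero]
    · rw [h]
  let T : J →ₗ[ℝ] ℝ := (traceL J).comp (L z)
  have hTapp : ∀ x, T x = traceL J (x * z) := fun x => by rw [mul_comm]; rfl
  have hTp : ∀ {p : J}, IsPrimitiveIdempotent p → T p = 1 := by
    intro p hp
    rw [hTapp, hzp hp, map_smul, smul_eq_mul, inv_mul_cancel₀ (hpos hp)]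
  have hprim : ∀ {p q : J} (y : J), IsPrimitiveIdempotent p → IsPrimitiveIdempotent q →
      T ((p * y) * q) = T (p * (y * q)) := by
    intro p q y hp hq
    rw [hTapp, hTapp, hT.assoc (p * y) q z, hzp hq, mul_comm p (y * q), hT.assoc (y * q) p z, hzp hp, mul_smul_comm,
      mul_smul_comm, map_smul, map_smul, mul_comm (y * q) p, ← hT.assoc p y q]
    rcases hreal.orthogonal_or_traceL_eq hp hq with h | h
    · rw [mul_comm p y, hT.assoc, h, jmul_zero, map_zero, smul_zero, smul_zero]
    · rw [h]
  have hframe : ∀ {r : ℕ} {p : Fin r → J} (lam : Fin r → ℝ), IsJordanFrame p →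
      T (∑ i, lam i • p i) = ∑ i, lam i := by
    intro r p lam hp
    rw [map_sum]
    exact Finset.sum_congr rfl fun i _ => by
      rw [map_smul, hTp (hp.primitive i), smul_eq_mul, mul_one]
  refine ⟨T, ⟨fun x y w => ?_, fun x hx => ?_⟩, fun x => ?_⟩
  · obtain ⟨r, p, lam, hp, rfl⟩ := hreal.exists_isSpectralDecomposition x
    obtain ⟨s, q, mu, hq, rfl⟩ := hreal.exists_isSpectralDecomposition w
    simp only [jsum_mul, jmul_sum, map_sum, smul_mul_assoc, mul_smul_comm, map_smul,
      hprim y (hp.primitive _) (hq.primitive _)]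
  · obtain ⟨r, p, lam, hp, rfl⟩ := hreal.exists_isSpectralDecomposition x
    rw [hp.sum_mul_sum, hframe _ hp]
    refine lt_of_le_of_ne (Finset.sum_nonneg fun i _ => mul_self_nonneg _) fun h => hx ?_
    rw [eq_comm, Finset.sum_eq_zero_iff_of_nonneg fun i _ => mul_self_nonneg _] at h
    refine Finset.sum_eq_zero fun i hi => ?_
    rw [mul_self_eq_zero.1 (h i hi), zero_smul]
  · have hex : ∃ s : ℝ, ∃ (r : ℕ) (p : Fin r → J) (lam : Fin r → ℝ),
        IsSpectralDecomposition x p lam ∧ s = ∑ i, lam i := by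
      obtain ⟨r, p, lam, h⟩ := hreal.exists_isSpectralDecomposition x
      exact ⟨_, r, p, lam, h, rfl⟩
    rw [jtrace, dif_pos hex]
    obtain ⟨r, p, lam, ⟨hp, hx⟩, hs⟩ := hex.choose_spec
    rw [hs, ← hframe lam hp, ← hx]

end JordanTrace

/-! ### The Jordan inverse on the cone. -/

section Inverse

variable {J : Type*} [NormedAddCommGroup J] [NormedSpace ℝ J] [CommMagma J]
  [LeftDistribClass J] [SMulCommClass ℝ J J] [FiniteDimensional ℝ J] [IsCommJordan J]

/-- T(a d²) = T((ad)d) is positive for d ≠ 0. Consequently ab = e alone determines b. -/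
lemma FormallyReal.mul_left_injective (hreal : FormallyReal J) {a b c : J}
    (ha : a ∈ symmetricCone J) (h : a * b = a * c) : b = c := by
  have hT := hreal.isTraceForm_traceL
  by_contra hne
  have h1 := (hT.mem_symmetricCone_iff hreal).1 ha (b - c) (sub_ne_zero.2 hne)
  rw [← hT.assoc, jmul_sub a b c, h, sub_self, jzero_mul, map_zero] at h1
  exact lt_irrefl _ h1

lemma IsJordanFrame.isJordanInverse {r : ℕ} {p : Fin r → J} (hp : IsJordanFrame p)
    {lam : Fin r → ℝ} (hlam : ∀ i, 0 < lam i) :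
    IsJordanInverse (∑ i, lam i • p i) (∑ i, (lam i)⁻¹ • p i) := by
  constructor
  · rw [hp.sum_mul_sum]
    convert hp.sum_identity using 3 with i
    rw [mul_inv_cancel₀ (hlam i).ne', one_smul]
  · rw [hp.sum_mul_sum, hp.sum_mul_sum]
    refine Finset.sum_congr rfl fun i _ => ?_
    rw [mul_assoc, mul_inv_cancel₀ (hlam i).ne', mul_one]

lemma FormallyReal.eq_jinv (hreal : FormallyReal J) {a b : J} (ha : a ∈ symmetricCone J)
    (h : IsJordanInverse a b) : b = jinv a := by
  have hex : ∃ b, IsJordanInverse a b := ⟨b, h⟩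
  rw [jinv, dif_pos hex]
  exact hreal.mul_left_injective ha (h.1.unique hex.choose_spec.1)

lemma FormallyReal.jinv_sum (hreal : FormallyReal J) {r : ℕ} {p : Fin r → J}
    (hp : IsJordanFrame p) {lam : Fin r → ℝ} (hlam : ∀ i, 0 < lam i) :
    jinv (∑ i, lam i • p i) = ∑ i, (lam i)⁻¹ • p i :=
  (hreal.eq_jinv (hp.mem_symmetricCone hlam) (hp.isJordanInverse hlam)).symm

lemma FormallyReal.isJordanInverse_jinv (hreal : FormallyReal J) {a : J}
    (ha : a ∈ symmetricCone J) : IsJordanInverse a (jinv a) := by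
  obtain ⟨r, p, lam, ⟨hp, rfl⟩, hlam⟩ := ha
  rw [hreal.jinv_sum hp hlam]
  exact hp.isJordanInverse hlam

lemma FormallyReal.jinv_mem (hreal : FormallyReal J) {a : J} (ha : a ∈ symmetricCone J) :
    jinv a ∈ symmetricCone J := by
  obtain ⟨r, p, lam, ⟨hp, rfl⟩, hlam⟩ := ha
  rw [hreal.jinv_sum hp hlam]
  exact hp.mem_symmetricCone fun i => inv_pos.2 (hlam i)

lemma FormallyReal.jinv_jinv (hreal : FormallyReal J) {a : J} (ha : a ∈ symmetricCone J) :
    jinv (jinv a) = a := by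
  obtain ⟨r, p, lam, ⟨hp, rfl⟩, hlam⟩ := ha
  rw [hreal.jinv_sum hp hlam, hreal.jinv_sum hp fun i => inv_pos.2 (hlam i)]
  simp only [inv_inv]

lemma smul_mem_symmetricCone {a : J} (ha : a ∈ symmetricCone J) {c : ℝ} (hc : 0 < c) :
    c • a ∈ symmetricCone J := by
  obtain ⟨r, p, lam, ⟨hp, rfl⟩, hlam⟩ := ha
  simp only [Finset.smul_sum, smul_smul]
  exact hp.mem_symmetricCone fun i => mul_pos hc (hlam i)

lemma smul_mem_symmetricCone_iff {a : J} {c : ℝ} (hc : 0 < c) :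
    c • a ∈ symmetricCone J ↔ a ∈ symmetricCone J := by
  refine ⟨fun h => ?_, fun h => smul_mem_symmetricCone h hc⟩
  have := smul_mem_symmetricCone h (inv_pos.2 hc)
  rwa [smul_smul, inv_mul_cancel₀ hc.ne', one_smul] at this

lemma FormallyReal.jinv_smul (hreal : FormallyReal J) {a : J} (ha : a ∈ symmetricCone J) {c : ℝ}
    (hc : 0 < c) : jinv (c • a) = c⁻¹ • jinv a := by
  obtain ⟨r, p, lam, ⟨hp, rfl⟩, hlam⟩ := ha
  rw [hreal.jinv_sum hp hlam]
  simp only [Finset.smul_sum, smul_smul]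
  rw [hreal.jinv_sum hp fun i => mul_pos hc (hlam i)]
  simp only [mul_inv]

lemma FormallyReal.P_jinv_self (hreal : FormallyReal J) {a : J} (ha : a ∈ symmetricCone J) :
    P a (jinv a) = a := by
  obtain ⟨r, p, lam, ⟨hp, rfl⟩, hlam⟩ := ha
  rw [hreal.jinv_sum hp hlam, hp.P_sum]
  refine Finset.sum_congr rfl fun i _ => ?_
  rw [pow_two, mul_assoc, mul_inv_cancel₀ (hlam i).ne', mul_one]

lemma FormallyReal.exists_expL_jinv (hreal : FormallyReal J) {e : J} (he : IsIdentity e) {a : J}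
    (ha : a ∈ symmetricCone J) : ∃ v : J, a = expL v 1 e ∧ jinv a = expL v (-1) e := by
  obtain ⟨r, p, lam, ⟨hp, rfl⟩, hlam⟩ := ha
  refine ⟨∑ i, Real.log (lam i) • p i, ?_, ?_⟩
  · rw [hp.expL_apply he]
    exact Finset.sum_congr rfl fun i _ => by rw [one_mul, Real.exp_log (hlam i)]
  · rw [hp.expL_apply he, hreal.jinv_sum hp hlam]
    exact Finset.sum_congr rfl fun i _ => by
      rw [neg_one_mul, Real.exp_neg, Real.exp_log (hlam i)]

lemma FormallyReal.P_jinv_mul (hreal : FormallyReal J) {a : J} (ha : a ∈ symmetricCone J) :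
    P (jinv a) * P a = 1 := by
  obtain ⟨e, he⟩ := hreal.isTraceForm_traceL.exists_identity
  obtain ⟨v, h1, h2⟩ := hreal.exists_expL_jinv he ha
  have h : PCLM (jinv a) * PCLM a = 1 := by
    rw [h1, ← h1, h2, PCLM_expL_identity he, h1, PCLM_expL_identity he, mul_assoc,
      ← mul_assoc (expL v (-1)) (expL v 1), expL_neg_mul, one_mul, expL_neg_mul]
  ext y
  exact congrArg (fun A : J →L[ℝ] J => A y) h

lemma FormallyReal.P_mul_jinv (hreal : FormallyReal J) {a : J} (ha : a ∈ symmetricCone J) :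
    P a * P (jinv a) = 1 := by
  have := hreal.P_jinv_mul (hreal.jinv_mem ha)
  rwa [hreal.jinv_jinv ha] at this

lemma FormallyReal.P_jinv_apply (hreal : FormallyReal J) {a : J} (ha : a ∈ symmetricCone J)
    (y : J) : P (jinv a) (P a y) = y :=
  congrArg (fun A : Module.End ℝ J => A y) (hreal.P_jinv_mul ha)

lemma FormallyReal.P_apply_jinv (hreal : FormallyReal J) {a : J} (ha : a ∈ symmetricCone J)
    (y : J) : P a (P (jinv a) y) = y :=
  congrArg (fun A : Module.End ℝ J => A y) (hreal.P_mul_jinv ha)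

lemma FormallyReal.inverse_P (hreal : FormallyReal J) {a : J} (ha : a ∈ symmetricCone J) :
    Ring.inverse (P a) = P (jinv a) :=
  Ring.inverse_unit (⟨P a, P (jinv a), hreal.P_mul_jinv ha, hreal.P_jinv_mul ha⟩ : (Module.End ℝ J)ˣ)

/-- The fundamental formula on the symmetric cone. -/
lemma FormallyReal.P_P (hreal : FormallyReal J) {a : J} (ha : a ∈ symmetricCone J) (y z : J) :
    P (P a y) z = P a (P y (P a z)) :=
  congrArg (fun A : J →L[ℝ] J => A z) (hreal.PCLM_PCLM_of_mem ha y)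

/-- On the cone P(b) is injective and P(b)b⁻¹ = b, so the claim can be tested after applying
P(P(a)y), where the fundamental formula computes it. -/
lemma FormallyReal.jinv_P (hreal : FormallyReal J) {a y : J} (ha : a ∈ symmetricCone J)
    (hy : y ∈ symmetricCone J) : jinv (P a y) = P (jinv a) (jinv y) := by
  have h := hreal.P_mem ha hy
  apply hreal.P_injective h
  rw [hreal.P_jinv_self h, hreal.P_P ha, hreal.P_apply_jinv ha, hreal.P_jinv_self hy]

lemma FormallyReal.P_mem_iff (hreal : FormallyReal J) {a y : J} (ha : a ∈ symmetricCone J) :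
    P a y ∈ symmetricCone J ↔ y ∈ symmetricCone J := by
  refine ⟨fun h => ?_, hreal.P_mem ha⟩
  have := hreal.P_mem (hreal.jinv_mem ha) h
  rwa [hreal.P_jinv_apply ha] at this

lemma exists_sqrt {a : J} (ha : a ∈ symmetricCone J) :
    ∃ b ∈ symmetricCone J, b * b = a := by
  obtain ⟨r, p, lam, ⟨hp, rfl⟩, hlam⟩ := ha
  refine ⟨_, hp.mem_symmetricCone fun i => Real.sqrt_pos.2 (hlam i), ?_⟩
  rw [hp.sum_mul_sum]
  exact Finset.sum_congr rfl fun i _ => by rw [Real.mul_self_sqrt (hlam i).le]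

lemma FormallyReal.jinv_mul_self (hreal : FormallyReal J) {a : J} (ha : a ∈ symmetricCone J) :
    jinv (a * a) = jinv a * jinv a := by
  obtain ⟨r, p, lam, ⟨hp, rfl⟩, hlam⟩ := ha
  rw [hreal.jinv_sum hp hlam, hp.sum_mul_sum, hp.sum_mul_sum,
    hreal.jinv_sum hp fun i => mul_pos (hlam i) (hlam i)]
  simp only [mul_inv]

/-- Inversion reverses the order of the cone. -/
lemma FormallyReal.jinv_sub_jinv_mem (hreal : FormallyReal J) {a b : J} (ha : a ∈ symmetricCone J)
    (hb : b ∈ symmetricCone J) (h : b - a ∈ symmetricCone J) :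
    jinv a - jinv b ∈ symmetricCone J := by
  obtain ⟨e, he⟩ := hreal.isTraceForm_traceL.exists_identity
  -- For a = c², the cone automorphism P(c⁻¹) takes a to e; then a single Jordan frame diagonalizes
  -- everything.
  obtain ⟨c, hc, rfl⟩ := exists_sqrt ha
  have hc' := hreal.jinv_mem hc
  have hd := hreal.P_mem hc' hb
  have hinv : jinv (P (jinv c) b) = P c (jinv b) := by
    rw [hreal.jinv_P hc' hb, hreal.jinv_jinv hc]
  have h1 : P (jinv c) b - e ∈ symmetricCone J := by
    have := hreal.P_mem hc' h
    rwa [map_sub, ← he.P_apply_self, hreal.P_jinv_apply hc] at this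
  have h2 : e - jinv (P (jinv c) b) ∈ symmetricCone J := by
    obtain ⟨r, p, lam, ⟨hp, hdp⟩, hlam⟩ := hd
    rw [hdp] at h1 ⊢
    rw [hreal.jinv_sum hp hlam, ← hp.sum_eq he, ← Finset.sum_sub_distrib]
    rw [← hp.sum_eq he, ← Finset.sum_sub_distrib] at h1
    have h3 : ∑ i, (lam i - 1) • p i ∈ symmetricCone J := by
      simpa only [sub_smul, one_smul] using h1
    have h4 := hp.mem_symmetricCone (lam := fun i => 1 - (lam i)⁻¹) fun i => by
      have := hreal.pos_of_sum_mem hp h3 i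
      exact sub_pos.2 (inv_lt_one_of_one_lt₀ (by linarith))
    simpa only [sub_smul, one_smul] using h4
  have h3 := hreal.P_mem hc' h2
  rwa [hinv, map_sub, hreal.P_jinv_apply hc, he.P_apply_self, ← hreal.jinv_mul_self hc] at h3

end Inverse

/-! ### Behaviour of M and of the two metrics. -/

section ConeMetrics

variable {J : Type*} [NormedAddCommGroup J] [NormedSpace ℝ J] [CommMagma J]
  [LeftDistribClass J] [SMulCommClass ℝ J J] [FiniteDimensional ℝ J] [IsCommJordan J]

/-- Holds for each t separately, so the sets defining M(a,b) and M(b⁻¹,a⁻¹) coincide and no property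
of the infimum is needed. -/
lemma FormallyReal.sub_mem_iff_jinv (hreal : FormallyReal J) {a b : J} (ha : a ∈ symmetricCone J)
    (hb : b ∈ symmetricCone J) {t : ℝ} (ht : 0 < t) :
    t • b - a ∈ symmetricCone J ↔ t • jinv a - jinv b ∈ symmetricCone J := by
  have htb := smul_mem_symmetricCone hb ht
  have key : t • jinv a - jinv b = t • (jinv a - jinv (t • b)) := by
    rw [hreal.jinv_smul hb ht, smul_sub, smul_smul, mul_inv_cancel₀ ht.ne', one_smul]
  rw [key, smul_mem_symmetricCone_iff ht]
  refine ⟨hreal.jinv_sub_jinv_mem ha htb, fun h => ?_⟩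
  have := hreal.jinv_sub_jinv_mem (hreal.jinv_mem htb) (hreal.jinv_mem ha) h
  rwa [hreal.jinv_jinv ha, hreal.jinv_jinv htb] at this

lemma FormallyReal.M_eq_M_jinv (hreal : FormallyReal J) {a b : J} (ha : a ∈ symmetricCone J)
    (hb : b ∈ symmetricCone J) : M a b = M (jinv b) (jinv a) := by
  unfold M
  congr 1
  ext t
  exact and_congr_right fun ht => hreal.sub_mem_iff_jinv ha hb ht

lemma FormallyReal.M_P (hreal : FormallyReal J) {x : J} (hx : x ∈ symmetricCone J) (a b : J) :
    M (P x a) (P x b) = M a b := by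
  unfold M
  congr 1
  ext t
  refine and_congr_right fun _ => ?_
  rw [← map_smul, ← map_sub, hreal.P_mem_iff hx]

/-- f is an involution of the cone exchanging M(a,b) and M(b,a). Prescribing f only on the cone
covers both inversion (x = e) and the geodesic inversions. -/
lemma FormallyReal.isConeIsometry_P_jinv (hreal : FormallyReal J) {x : J}
    (hx : x ∈ symmetricCone J) {f : J → J} (hf : ∀ y ∈ symmetricCone J, f y = P x (jinv y)) :
    IsConeIsometry thompsonDist f ∧ IsConeIsometry hilbertDist f := by
  have hmaps : Set.MapsTo f (symmetricCone J) (symmetricCone J) := fun y hy => by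
    rw [hf y hy]; exact hreal.P_mem hx (hreal.jinv_mem hy)
  have hinv : Set.InvOn f f (symmetricCone J) (symmetricCone J) := by
    have : Set.LeftInvOn f f (symmetricCone J) := fun y hy => by
      rw [hf _ (hmaps hy), hf y hy, hreal.jinv_P hx (hreal.jinv_mem hy), hreal.jinv_jinv hy,
        hreal.P_apply_jinv hx]
    exact ⟨this, this⟩
  have hbij := hinv.bijOn hmaps hmaps
  have hM : ∀ a ∈ symmetricCone J, ∀ b ∈ symmetricCone J, M (f a) (f b) = M b a := by
    intro a ha b hb
    rw [hf a ha, hf b hb, hreal.M_P hx, hreal.M_eq_M_jinv hb ha]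
  refine ⟨⟨hbij, fun a ha b hb => ?_⟩, ⟨hbij, fun a ha b hb => ?_⟩⟩
  · rw [thompsonDist, thompsonDist, hM a ha b hb, hM b hb a ha, max_comm]
  · rw [hilbertDist, hilbertDist, hM a ha b hb, hM b hb a ha, mul_comm]

end ConeMetrics

/-! ### Geodesics and geodesic inversions. -/

/-- Global uniqueness for an autonomous differential equation with a `C¹` right-hand side. -/
lemma eq_of_contDiff_ode {E : Type*} [NormedAddCommGroup E] [NormedSpace ℝ E]
    [FiniteDimensional ℝ E] {F : E → E} (hF : ContDiff ℝ 1 F) {f g : ℝ → E}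
    (hf : ∀ t, HasDerivAt f (F (f t)) t) (hg : ∀ t, HasDerivAt g (F (g t)) t) (h0 : f 0 = g 0)
    (t : ℝ) : f t = g t := by
  -- Over [-N, N] both curves stay in one closed ball, where F is Lipschitz; the added 1 puts t in
  -- the open interval.
  set N : ℝ := |t| + 1
  have hN : 0 < N := by positivity
  have hfc : Continuous f := continuous_iff_continuousAt.2 fun t => (hf t).continuousAt
  have hgc : Continuous g := continuous_iff_continuousAt.2 fun t => (hg t).continuousAt
  obtain ⟨A, hA⟩ := (isCompact_Icc (a := -N) (b := N)).exists_bound_of_continuousOn hfc.continuousOn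
  obtain ⟨B, hB⟩ := (isCompact_Icc (a := -N) (b := N)).exists_bound_of_continuousOn hgc.continuousOn
  obtain ⟨K, hK⟩ := (hF.contDiffOn (s := Metric.closedBall 0 (max A B))).exists_lipschitzOnWith
    one_ne_zero (convex_closedBall _ _) (isCompact_closedBall _ _)
  have key := ODE_solution_unique_of_mem_Ioo (v := fun _ => F) (f := f) (g := g) (K := K)
    (s := fun _ => Metric.closedBall 0 (max A B)) (a := -N) (b := N) (t₀ := 0)
    (fun _ _ => hK) ⟨by linarith, hN⟩
    (fun s hs => ⟨hf s, mem_closedBall_zero_iff.2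
      ((hA s (Set.Ioo_subset_Icc_self hs)).trans (le_max_left _ _))⟩)
    (fun s hs => ⟨hg s, mem_closedBall_zero_iff.2
      ((hB s (Set.Ioo_subset_Icc_self hs)).trans (le_max_right _ _))⟩) h0
  refine key ⟨?_, ?_⟩
  · have := neg_abs_le t
    simp only [N]; linarith
  · have := le_abs_self t
    simp only [N]; linarith

section Geodesics

variable {J : Type*} [NormedAddCommGroup J] [NormedSpace ℝ J] [CommMagma J]
  [LeftDistribClass J] [SMulCommClass ℝ J J] [FiniteDimensional ℝ J]

/-- The geodesic equation in Hamiltonian form, `w` being the momentum. -/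
structure IsHamiltonianFlow (γ w : ℝ → J) : Prop where
  mem : ∀ t, γ t ∈ symmetricCone J
  hasDerivAt_position : ∀ t, HasDerivAt γ (P (γ t) (w t)) t
  hasDerivAt_momentum : ∀ t, HasDerivAt w (-P (w t) (γ t)) t

lemma IsTraceForm.hasDerivAt {T : J →ₗ[ℝ] ℝ} (hT : IsTraceForm T) {w : ℝ → J} {w' : J} {t : ℝ}
    (h : ∀ v, HasDerivAt (fun s => T (w s * v)) (T (w' * v)) t) : HasDerivAt w w' t := by
  let b := Module.finBasis ℝ J
  let Φ : J →ₗ[ℝ] (Fin (Module.finrank ℝ J) → ℝ) := LinearMap.pi fun i => T.comp (L (b i))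
  have hΦ : ∀ x i, Φ x i = T (x * b i) := fun x i => by rw [mul_comm]; rfl
  have hker : LinearMap.ker Φ = ⊥ := by
    rw [LinearMap.ker_eq_bot']
    intro x hx
    have h1 : T.comp (L x) = 0 := b.ext fun i => by
      have := congrFun hx i
      rwa [hΦ] at this
    exact hT.eq_zero (congrArg (fun f : J →ₗ[ℝ] ℝ => f x) h1)
  obtain ⟨Ψ, hΨ⟩ := LinearMap.exists_leftInverse_of_injective Φ hker
  have hΨ' : ∀ x, LinearMap.toContinuousLinearMap Ψ (Φ x) = x := fun x =>
    congrArg (fun f : J →ₗ[ℝ] J => f x) hΨ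
  have h1 : HasDerivAt (fun s => Φ (w s)) (Φ w') t := by
    rw [hasDerivAt_pi]
    intro i
    simp only [hΦ]
    exact h (b i)
  have h2 := (LinearMap.toContinuousLinearMap Ψ).hasFDerivAt.comp_hasDerivAt t h1
  rw [hΨ'] at h2
  refine h2.congr_of_eventuallyEq (Filter.Eventually.of_forall fun s => ?_)
  exact (hΨ' (w s)).symm

variable [IsCommJordan J]

lemma FormallyReal.metric_eq (hreal : FormallyReal J) {T : J →ₗ[ℝ] ℝ}
    (hjT : ∀ x : J, jtrace x = T x) {x : J} (hx : x ∈ symmetricCone J) (u v : J) :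
    metric x u v = T (P (jinv x) u * v) := by
  rw [metric, hjT, hreal.inverse_P hx]

/-- The left factor is half the derivative of P at x along v, applied to w. -/
lemma IsTraceForm.P_polarization {T : J →ₗ[ℝ] ℝ} (hT : IsTraceForm T) (x v w : J) :
    T ((x * (v * w) + v * (x * w) - (x * v) * w) * w) = T (P w x * v) := by
  rw [P_apply, jsub_mul, jsub_mul, add_mul, map_sub, map_sub, map_add, smul_mul_assoc, map_smul,
    smul_eq_mul]
  have h1 : T ((x * (v * w)) * w) = T ((w * (w * x)) * v) := by
    rw [hT.L_symm, mul_comm v w, hT.L_symm, mul_comm x w, mul_comm]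
  have h2 : T ((v * (x * w)) * w) = T ((w * (w * x)) * v) := by
    rw [mul_comm v, hT.assoc, mul_comm v w, ← hT.assoc, mul_comm (x * w), mul_comm x]
  have h3 : T (((x * v) * w) * w) = T (((w * w) * x) * v) := by
    rw [hT.assoc, mul_comm x v, hT.assoc, mul_comm v, mul_comm x]
  rw [h1, h2, h3]
  ring

/-- P(x)⁻¹ has derivative -P(x)⁻¹ (DP(x)v) P(x)⁻¹; with w = P(x)⁻¹u, `P_polarization` does the rest.
-/
lemma FormallyReal.hasDerivAt_metric (hreal : FormallyReal J) {T : J →ₗ[ℝ] ℝ}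
    (hT : IsTraceForm T) (hjT : ∀ x : J, jtrace x = T x) {x : J} (hx : x ∈ symmetricCone J)
    (u v : J) :
    HasDerivAt (fun s : ℝ => metric (x + s • v) u u)
      (-2 * T (P (P (jinv x) u) x * v)) 0 := by
  have hPinv : ∀ {y : J}, y ∈ symmetricCone J → PCLM y * PCLM (jinv y) = 1 ∧
      PCLM (jinv y) * PCLM y = 1 := fun hy =>
    ⟨by ext z; exact hreal.P_apply_jinv hy z, by ext z; exact hreal.P_jinv_apply hy z⟩
  have hinv : ∀ {y : J}, y ∈ symmetricCone J → Ring.inverse (PCLM y) = PCLM (jinv y) := fun hy =>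
    Ring.inverse_unit (⟨_, _, (hPinv hy).1, (hPinv hy).2⟩ : (J →L[ℝ] J)ˣ)
  have hline : HasDerivAt (fun s : ℝ => x + s • v) v 0 := by
    simpa using ((hasDerivAt_id (0 : ℝ)).smul_const v).const_add x
  have hx0 : x + (0 : ℝ) • v = x := by rw [zero_smul, add_zero]
  have hP := hasDerivAt_PCLM hline
  let U : (J →L[ℝ] J)ˣ := ⟨_, _, (hPinv hx).1, (hPinv hx).2⟩
  have hU := hasFDerivAt_ringInverse (𝕜 := ℝ) U
  have hR := HasFDerivAt.comp_hasDerivAt_of_eq (0 : ℝ) hU hP (by simp only [hx0]; rfl)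
  have hRu := hR.clm_apply (hasDerivAt_const (0 : ℝ) u)
  have hTc := T.toContinuousLinearMap.hasFDerivAt.comp_hasDerivAt (0 : ℝ)
    (hasDerivAt_jmul hRu (hasDerivAt_const (0 : ℝ) u))
  have hev : ∀ᶠ s : ℝ in nhds 0, x + s • v ∈ symmetricCone J :=
    hline.continuousAt.eventually
      ((hT.isOpen_symmetricCone hreal).mem_nhds (by simpa only [hx0] using hx))
  have hfin := hTc.congr_of_eventuallyEq (f₁ := fun s : ℝ => metric (x + s • v) u u) (by
    filter_upwards [hev] with s hs
    rw [hreal.metric_eq hjT hs]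
    change _ = T (Ring.inverse (PCLM (x + s • v)) u * u)
    rw [hinv hs, PCLM_apply])
  refine hfin.congr_deriv ?_
  rw [← hT.P_polarization]
  set w := P (jinv x) u
  simp only [hx0, map_zero, zero_add, jmul_zero, add_zero]
  change T ((-(PCLM (jinv x) * _ * PCLM (jinv x))) u * u) = _
  rw [neg_apply, mul_apply_eq_comp, mul_apply_eq_comp, PCLM_apply, PCLM_apply]
  change T (-(P (jinv x) ((2 : ℝ) • (x * (v * w) + v * (x * w) - (x * v) * w))) * u) = _
  rw [jneg_mul, map_neg, hT.P_symm, smul_mul_assoc, map_smul, smul_eq_mul, neg_mul]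

/-- For w = P(γ)⁻¹γ' one has ⟨γ', v⟩_γ = T(wv), so `hasDerivAt_metric` makes the geodesic equation
the momentum equation tested against T. -/
lemma FormallyReal.isGeodesic_iff (hreal : FormallyReal J) {γ : ℝ → J} :
    IsGeodesic γ ↔ ∃ w, IsHamiltonianFlow γ w := by
  obtain ⟨T, hT, hjT⟩ := hreal.exists_isTraceForm_jtrace
  constructor
  · intro h
    refine ⟨fun t => P (jinv (γ t)) (deriv γ t), h.mem, fun t => ?_, fun t => ?_⟩
    · rw [hreal.P_apply_jinv (h.mem t)]
      exact (h.differentiable t).hasDerivAt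
    · refine hT.hasDerivAt fun v => ?_
      have h1 := h.equation t v
      rw [(hreal.hasDerivAt_metric hT hjT (h.mem t) _ v).deriv] at h1
      simp only [hreal.metric_eq hjT (h.mem _)] at h1
      refine h1.congr_deriv ?_
      rw [jneg_mul (P _ _) v, map_neg]
      ring
  · rintro ⟨w, h⟩
    have hderiv : deriv γ = fun t => P (γ t) (w t) := funext fun t =>
      (h.hasDerivAt_position t).deriv
    refine ⟨h.mem, fun t => (h.hasDerivAt_position t).differentiableAt, fun t => ?_,
      fun t v => ?_⟩
    · rw [hderiv]
      exact ((hasDerivAt_PCLM (h.hasDerivAt_position t)).clm_apply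
        (h.hasDerivAt_momentum t)).differentiableAt
    · rw [(hreal.hasDerivAt_metric hT hjT (h.mem t) _ v).deriv]
      simp only [hreal.metric_eq hjT (h.mem _), hderiv, hreal.P_jinv_apply (h.mem _)]
      have h1 := T.toContinuousLinearMap.hasFDerivAt.comp_hasDerivAt t
        (hasDerivAt_jmul (h.hasDerivAt_momentum t) (hasDerivAt_const t v))
      refine h1.congr_deriv ?_
      rw [jmul_zero, zero_add, jneg_mul, map_neg]
      change -T _ = _
      ring

/-- Geodesics are preserved by the quadratic representation. -/
lemma FormallyReal.isGeodesic_P (hreal : FormallyReal J) {γ : ℝ → J} (hγ : IsGeodesic γ) {b : J}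
    (hb : b ∈ symmetricCone J) : IsGeodesic fun t => P b (γ t) := by
  obtain ⟨w, h⟩ := hreal.isGeodesic_iff.1 hγ
  have hb' := hreal.jinv_mem hb
  refine hreal.isGeodesic_iff.2 ⟨fun t => P (jinv b) (w t), fun t => hreal.P_mem hb (h.mem t),
    fun t => ?_, fun t => ?_⟩
  · rw [hreal.P_P hb, hreal.P_apply_jinv hb]
    exact (PCLM b).hasFDerivAt.comp_hasDerivAt t (h.hasDerivAt_position t)
  · rw [hreal.P_P hb', hreal.P_jinv_apply hb, ← map_neg]
    exact (PCLM (jinv b)).hasFDerivAt.comp_hasDerivAt t (h.hasDerivAt_momentum t)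

lemma IsJordanFrame.isHamiltonianFlow {r : ℕ} {p : Fin r → J} (hp : IsJordanFrame p)
    (lam : Fin r → ℝ) :
    IsHamiltonianFlow (fun t => ∑ i, Real.exp (t * lam i) • p i)
      (fun t => ∑ i, (lam i * Real.exp (-(t * lam i))) • p i) := by
  refine ⟨fun t => hp.mem_symmetricCone fun i => Real.exp_pos _, fun t => ?_, fun t => ?_⟩
  · refine (hasDerivAt_frame_exp lam t).congr_deriv ?_
    rw [hp.P_sum]
    refine Finset.sum_congr rfl fun i _ => ?_
    rw [Real.exp_neg]
    congr 1
    field_simp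
  · refine (hasDerivAt_sum_smul (f := fun i s => lam i * Real.exp (-(s * lam i)))
      (f' := fun i s => -(lam i ^ 2 * Real.exp (-(s * lam i)))) fun i => ?_).congr_deriv ?_
    · have := (((hasDerivAt_id t).mul_const (lam i)).neg.exp).const_mul (lam i)
      refine this.congr_deriv ?_
      simp only [id, Pi.neg_apply]
      ring
    · rw [hp.P_sum, ← Finset.sum_neg_distrib]
      refine Finset.sum_congr rfl fun i _ => ?_
      rw [← neg_smul, Real.exp_neg]
      congr 1
      field_simp

lemma contDiff_P_apply : ContDiff ℝ 1 fun z : J × J => P z.1 z.2 := by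
  have h : ∀ f g : J × J → J, ContDiff ℝ 1 f → ContDiff ℝ 1 g →
      ContDiff ℝ 1 fun z => f z * g z := fun f g hf hg =>
    ((mulCLM J).contDiff.comp hf).clm_apply hg
  simp only [P_apply]
  exact ((h _ _ contDiff_fst (h _ _ contDiff_fst contDiff_snd)).const_smul (2 : ℝ)).sub
    (h _ _ (h _ _ contDiff_fst contDiff_fst) contDiff_snd)

/-- Geodesics through the identity are reflected by inversion. -/
lemma FormallyReal.geodesic_neg_one (hreal : FormallyReal J) {γ : ℝ → J} (hγ : IsGeodesic γ)
    (h0 : IsIdentity (γ 0)) : γ (-1) = jinv (γ 1) := by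
  obtain ⟨w, h⟩ := hreal.isGeodesic_iff.1 hγ
  -- A frame diagonalizing the initial momentum gives an explicit solution with the same initial
  -- data, hence γ itself.
  obtain ⟨r, p, lam, hp, hw⟩ := hreal.exists_isSpectralDecomposition (w 0)
  have h' := hp.isHamiltonianFlow lam
  have hF : ContDiff ℝ 1 fun z : J × J => (P z.1 z.2, -P z.2 z.1) :=
    contDiff_P_apply.prodMk (contDiff_P_apply.comp (contDiff_snd.prodMk contDiff_fst)).neg
  have key := eq_of_contDiff_ode hF
    (f := fun t => (γ t, w t))
    (g := fun t => (∑ i, Real.exp (t * lam i) • p i,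
      ∑ i, (lam i * Real.exp (-(t * lam i))) • p i))
    (fun t => (h.hasDerivAt_position t).prodMk (h.hasDerivAt_momentum t))
    (fun t => (h'.hasDerivAt_position t).prodMk (h'.hasDerivAt_momentum t))
    (by simp [hp.sum_eq h0, hw])
  have hγt : ∀ t, γ t = ∑ i, Real.exp (t * lam i) • p i := fun t => congrArg Prod.fst (key t)
  rw [hγt, hγt, hreal.jinv_sum hp fun i => Real.exp_pos _]
  exact Finset.sum_congr rfl fun i _ => by rw [neg_mul, Real.exp_neg]

lemma FormallyReal.exists_geodesic (hreal : FormallyReal J) {e y : J} (he : IsIdentity e)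
    (hy : y ∈ symmetricCone J) : ∃ γ : ℝ → J, IsGeodesic γ ∧ γ 0 = e ∧ γ 1 = y := by
  obtain ⟨r, p, lam, ⟨hp, rfl⟩, hlam⟩ := hy
  refine ⟨_, hreal.isGeodesic_iff.2 ⟨_, hp.isHamiltonianFlow fun i => Real.log (lam i)⟩, ?_, ?_⟩
  · simp [hp.sum_eq he]
  · exact Finset.sum_congr rfl fun i _ => by rw [one_mul, Real.exp_log (hlam i)]

/-- With x = b², P(b⁻¹) moves x to e, where reflection is inversion; moving back gives
P(b)(P(b⁻¹)y)⁻¹ = P(b)²y⁻¹ = P(x)y⁻¹. The two directions yield uniqueness and existence of the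
reflected point. -/
lemma FormallyReal.isGeodesicReflection_iff (hreal : FormallyReal J) {x y z : J}
    (hx : x ∈ symmetricCone J) (hy : y ∈ symmetricCone J) :
    IsGeodesicReflection x y z ↔ z = P x (jinv y) := by
  obtain ⟨e, he⟩ := hreal.isTraceForm_traceL.exists_identity
  obtain ⟨b, hb, rfl⟩ := exists_sqrt hx
  have hb' := hreal.jinv_mem hb
  have hx' : P (jinv b) (b * b) = e := by rw [← he.P_apply_self, hreal.P_jinv_apply hb]
  have hPx : P (b * b) (jinv y) = P b (P b (jinv y)) := by
    rw [← he.P_apply_self, hreal.P_P hb, he.P_eq]; rfl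
  have hinv : jinv (P (jinv b) y) = P b (jinv y) := by
    rw [hreal.jinv_P hb' hy, hreal.jinv_jinv hb]
  rw [hPx]
  constructor
  · rintro ⟨γ, hγ, h0, h1, hz⟩
    have h := hreal.geodesic_neg_one (hreal.isGeodesic_P hγ hb')
      (by simp only [h0, hx']; exact he)
    rw [h1, hinv, hz] at h
    rw [← h, hreal.P_apply_jinv hb]
  · rintro rfl
    obtain ⟨γ, hγ, h0, h1⟩ := hreal.exists_geodesic he (hreal.P_mem hb' hy)
    refine ⟨_, hreal.isGeodesic_P hγ hb, ?_, ?_, ?_⟩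
    · simp only [h0, he.P_apply_self]
    · simp only [h1, hreal.P_apply_jinv hb]
    · rw [← hinv, ← h1, hreal.geodesic_neg_one hγ (by rw [h0]; exact he)]

lemma FormallyReal.geodesicInversion_eq (hreal : FormallyReal J) {x y : J}
    (hx : x ∈ symmetricCone J) (hy : y ∈ symmetricCone J) :
    geodesicInversion x y = P x (jinv y) := by
  have hex : ∃ z : J, IsGeodesicReflection x y z :=
    ⟨_, (hreal.isGeodesicReflection_iff hx hy).2 rfl⟩
  rw [geodesicInversion, dif_pos hex]
  exact (hreal.isGeodesicReflection_iff hx hy).1 hex.choose_spec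

end Geodesics

end EuclideanJordan

end

theorem mainTheorem10 {J : Type*} [NormedAddCommGroup J] [NormedSpace ℝ J]
    [FiniteDimensional ℝ J] [CommMagma J] [LeftDistribClass J] [SMulCommClass ℝ J J]
    [IsCommJordan J]
    (hreal : ∀ a b : J, a * a + b * b = 0 → a = 0 ∧ b = 0) :
    -- the algebra inversion is well defined on the cone, and `M(a,b) = M(b⁻¹,a⁻¹)`
    (∀ a ∈ EuclideanJordan.symmetricCone J,
      EuclideanJordan.IsJordanInverse a (EuclideanJordan.jinv a) ∧
        ∀ b : J, EuclideanJordan.IsJordanInverse a b → b = EuclideanJordan.jinv a) ∧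
    (∀ a ∈ EuclideanJordan.symmetricCone J, ∀ b ∈ EuclideanJordan.symmetricCone J,
      EuclideanJordan.M a b =
        EuclideanJordan.M (EuclideanJordan.jinv b) (EuclideanJordan.jinv a)) ∧
    -- the algebra inversion is an isometry for both metrics
    EuclideanJordan.IsConeIsometry EuclideanJordan.thompsonDist
      (EuclideanJordan.jinv : J → J) ∧
    EuclideanJordan.IsConeIsometry EuclideanJordan.hilbertDist
      (EuclideanJordan.jinv : J → J) ∧
    -- it is the geodesic inversion at the identity
    (∀ e : J, EuclideanJordan.IsIdentity e → ∀ a ∈ EuclideanJordan.symmetricCone J,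
      EuclideanJordan.geodesicInversion e a = EuclideanJordan.jinv a) ∧
    -- every geodesic inversion is well defined, is an isometry for both metrics,
    -- and maps rays to rays (so that it acts on the metric space of rays)
    (∀ x ∈ EuclideanJordan.symmetricCone J,
      (∀ y ∈ EuclideanJordan.symmetricCone J,
        EuclideanJordan.IsGeodesicReflection x y (EuclideanJordan.geodesicInversion x y) ∧
          ∀ z : J, EuclideanJordan.IsGeodesicReflection x y z →
            z = EuclideanJordan.geodesicInversion x y) ∧
      EuclideanJordan.IsConeIsometry EuclideanJordan.thompsonDist
        (EuclideanJordan.geodesicInversion x) ∧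
      EuclideanJordan.IsConeIsometry EuclideanJordan.hilbertDist
        (EuclideanJordan.geodesicInversion x) ∧
      (∀ y ∈ EuclideanJordan.symmetricCone J, ∀ c : ℝ, 0 < c → ∃ c' : ℝ, 0 < c' ∧
        EuclideanJordan.geodesicInversion x (c • y) =
          c' • EuclideanJordan.geodesicInversion x y)) := by
  have hR : EuclideanJordan.FormallyReal J := hreal
  obtain ⟨e₀, he₀⟩ := hR.isTraceForm_traceL.exists_identity
  have hjinv := hR.isConeIsometry_P_jinv (hR.identity_mem he₀) (f := EuclideanJordan.jinv)
    fun y _ => by rw [he₀.P_eq]; rfl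
  refine ⟨fun a ha => ⟨hR.isJordanInverse_jinv ha, fun b hb => hR.eq_jinv ha hb⟩,
    fun a ha b hb => hR.M_eq_M_jinv ha hb, hjinv.1, hjinv.2, fun e he a ha => ?_, fun x hx => ?_⟩
  · rw [hR.geodesicInversion_eq (hR.identity_mem he) ha, he.P_eq]
    rfl
  · have hiso := hR.isConeIsometry_P_jinv hx fun y hy => hR.geodesicInversion_eq hx hy
    refine ⟨fun y hy => ?_, hiso.1, hiso.2, fun y hy c hc => ⟨c⁻¹, inv_pos.2 hc, ?_⟩⟩
    · rw [hR.geodesicInversion_eq hx hy]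
      exact ⟨(hR.isGeodesicReflection_iff hx hy).2 rfl,
        fun z hz => (hR.isGeodesicReflection_iff hx hy).1 hz⟩
    · rw [hR.geodesicInversion_eq hx hy,
        hR.geodesicInversion_eq hx (EuclideanJordan.smul_mem_symmetricCone hy hc),
        hR.jinv_smul hy hc, map_smul]
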